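/- **Setting.** Let $G$ be a countable discrete group with a sofic approximation $\sigma_k\colon G\to S_{d_k}$, $d_k\ge 1$; that is, with $u_n$ the uniform probability measure on $\{1,\dots,n\}$ and $d_{\mathrm{Hamm}}(p,q)=u_n(\{j:p(j)\neq q(j)\})$ on $S_n$, we have $d_{\mathrm{Hamm}}(\sigma_k(gh),\sigma_k(g)\sigma_k(h))\to 0$ for all $g,h\in G$ and $d_{\mathrm{Hamm}}(\sigma_k(g),\sigma_k(h))\to 1$ for all $g\ne h$, as $k\to\infty$. Let $\omega$ be a free ultrafilter on $\mathbb N$. Let $X$ be a compact metrizable group on which $G$ acts by continuous automorphisms, with Haar probability measure $m_X$; for a closed subgroup $H\le X$ let $m_H$ be its Haar probability measure, viewed as a Borel probability measure on $X$. Let $Z_\omega=\prod_k\{1,\dots,d_k\}/\!\sim$, where $(j_k)\sim(j_k')$ iff $\{k:j_k=j_k'\}\in\omega$, with the $\sigma$-algebra generated by the internal sets $\prod_{k\to\omega}A_k=\{[(j_k)_k]:\{k:j_k\in A_k\}\in\omega\}$, $A_k\subseteq\{1,\dots,d_k\}$, and the Loeb measure $u_\omega$, which is determined by $u_\omega(\prod_{k\to\omega}A_k)=\lim_{k\to\omega}|A_k|/d_k$.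 The group $\prod_{k\to\omega}S_{d_k}$, the quotient of $\prod_kS_{d_k}$ by $\{(p_k)_k:\lim_{k\to\omega}d_{\mathrm{Hamm}}(p_k,\mathrm{id})=0\}$, acts on $(Z_\omega,u_\omega)$ (up to null sets) by $[(p_k)_k]\cdot[(j_k)_k]=[(p_k(j_k))_k]$; put $\sigma_\omega(g)=[(\sigma_k(g))_k]$. For a Polish space $K$, $\mathrm{Meas}(Z_\omega,K)$ is the set of measurable maps $Z_\omega\to K$ modulo a.e. equality. * A *topological microstate* is a measurable map $\Phi\colon Z_\omega\to X$ such that, for every $g\in G$, $\Phi(\sigma_\omega(g)z)=g\Phi(z)$ for $u_\omega$-a.e. $z$. A closed set $Y\subseteq X$ *absorbs all topological microstates* if $\Phi(z)\in Y$ for a.e. $z$, for every topological microstate $\Phi$. * A sequence of Borel probability measures $\mu_k\in\mathrm{Prob}(X^{d_k})$ is *asymptotically supported on topological microstates* if for all $g\in G$, all open $U\supseteq\{(x,x):x\in X\}$ in $X\times X$ and all $\varepsilon>0$, $$\lim_{k\to\omega}\mu_k\bigl(\{\phi: u_{d_k}(\{j:(\phi(\sigma_k(g)(j)),g\phi(j))\in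 U\})>1-\varepsilon\}\bigr)=1.$$ * Let $\mu_{k,j}\in\mathrm{Prob}(X)$ be the $j$-th marginal of $\mu_k$. The sequence $(\mu_k)$ *converges locally weak\** to $m\in\mathrm{Prob}(X)$ if $\lim_{k\to\omega}u_{d_k}(\{j:\mu_{k,j}\in\mathcal O\})=1$ for every weak\* neighbourhood $\mathcal O$ of $m$. Call $m$ a *local weak\* limit of measures on topological microstates* if some $(\mu_k)$ which is asymptotically supported on topological microstates converges locally weak\* to $m$. * $\mathcal L_\omega\subseteq\mathrm{Meas}(Z_\omega,\mathrm{Prob}(X))$ is the set of all maps $[(j_k)_k]\mapsto\lim_{k\to\omega}\mu_{k,j_k}$ (weak\* ultralimit), over all $(\mu_k)$ asymptotically supported on topological microstates. * $\mathrm{Sub}(X)$ is the space of closed subgroups of $X$ with the Hausdorff topology, and $\mathcal S_\omega$ is the set of $Y\in\mathrm{Meas}(Z_\omega,\mathrm{Sub}(X))$ such that $z\mapsto m_{Y(z)}$ lies in $\mathcal L_\omega$, ordered by a.e. inclusion. **Statement.** Assume that the centralizer $G'_\omega$ of $\sigma_\omega(G)$ in $\prod_{k\to\omega}S_{d_k}$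 acts ergodically on $(Z_\omega,u_\omega)$: every measurable $A\subseteq Z_\omega$ that is invariant up to null sets under each element of $G'_\omega$ is null or conull. Then there is a closed $G$-invariant subgroup $Y$ of $X$ such that 1. the constant map $Y$ is the greatest element of $\mathcal S_\omega$; 2. $Y$ is the largest closed subgroup $H$ of $X$ such that $m_H$ is a local weak\* limit of measures on topological microstates; 3. $Y$ is the smallest closed subgroup of $X$ which absorbs all topological microstates. Moreover, $m_X$ is not a local weak\* limit of measures on topological microstates if and only if some proper closed $G$-invariant subgroup of $X$ absorbs all topological microstates. -/

import Mathlib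

open Filter Topology MeasureTheory ProbabilityTheory Set

noncomputable section

namespace SoficAlg

/-! ### Uniform measures, Hamming distance, sofic approximations -/

/-- The uniform probability measure `u_n` on an `n`-point set. -/
def unif (n : ℕ) : Measure (Fin n) := uniformOn Set.univ

/-- The normalized Hamming distance on the symmetric group `S_n`. -/
def hamm {n : ℕ} (p q : Equiv.Perm (Fin n)) : ENNReal := unif n {j | p j ≠ q j}

/-- `σ_k : G → S_{d_k}` is a sofic approximation of `G`: it is asymptotically multiplicative
and asymptotically free. -/
structure IsSoficApprox {G : Type*} [Group G] {d : ℕ → ℕ}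
    (σ : ∀ k, G → Equiv.Perm (Fin (d k))) : Prop where
  mul : ∀ g h : G, Tendsto (fun k => hamm (σ k (g * h)) (σ k g * σ k h)) atTop (𝓝 0)
  free : ∀ g h : G, g ≠ h → Tendsto (fun k => hamm (σ k g) (σ k h)) atTop (𝓝 1)

/-- The ultralimit of a sequence (it exists and is unique in a compact Hausdorff space). -/
def ulim {K : Type*} [TopologicalSpace K] (ω : Ultrafilter ℕ) (x : ℕ → K) : K := (ω.map x).lim

theorem tendsto_ulim {K : Type*} [TopologicalSpace K] [CompactSpace K] (ω : Ultrafilter ℕ)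
    (x : ℕ → K) : Tendsto x ω (𝓝 (ulim ω x)) :=
  (ω.map x).le_nhds_lim

/-! ### The Loeb measure space -/

/-- The ultraproduct `Z_ω` of the sets `{1, …, d_k}`. -/
def LoebSpace (d : ℕ → ℕ) (ω : Ultrafilter ℕ) : Type :=
  (ω : Filter ℕ).Product (fun k => Fin (d k))

variable {d : ℕ → ℕ} {ω : Ultrafilter ℕ}

/-- The class `(j_k)_{k → ω}` in `Z_ω` of a sequence `(j_k)_k`. -/
def LoebSpace.mk (ω : Ultrafilter ℕ) (j : ∀ k, Fin (d k)) : LoebSpace d ω :=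
  Quotient.mk (productSetoid (ω : Filter ℕ) (fun k => Fin (d k))) j

theorem LoebSpace.exists_mk (z : LoebSpace d ω) : ∃ j : ∀ k, Fin (d k), LoebSpace.mk ω j = z :=
  Quotient.exists_rep (s := productSetoid (ω : Filter ℕ) (fun k => Fin (d k))) z

theorem LoebSpace.mk_eq_mk {i j : ∀ k, Fin (d k)} :
    LoebSpace.mk ω i = LoebSpace.mk ω j ↔ ∀ᶠ k in (ω : Filter ℕ), i k = j k :=
  Quotient.eq (r := productSetoid (ω : Filter ℕ) (fun k => Fin (d k)))

/-- The internal set `∏_{k → ω} A_k ⊆ Z_ω`. (Membership is tested along `ω`, so that finitely many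
empty `A_k` do not matter.) -/
def internalSet (ω : Ultrafilter ℕ) (A : ∀ k, Set (Fin (d k))) : Set (LoebSpace d ω) :=
  {z | ∃ j : ∀ k, Fin (d k), LoebSpace.mk ω j = z ∧ ∀ᶠ k in (ω : Filter ℕ), j k ∈ A k}

theorem mk_mem_internalSet {A : ∀ k, Set (Fin (d k))} {j : ∀ k, Fin (d k)} :
    LoebSpace.mk ω j ∈ internalSet ω A ↔ ∀ᶠ k in (ω : Filter ℕ), j k ∈ A k := by
  constructor
  · rintro ⟨i, hi, h⟩
    filter_upwards [LoebSpace.mk_eq_mk.1 hi, h] with k h1 h2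
    rwa [← h1]
  · intro h
    exact ⟨j, rfl, h⟩

/-- The `σ`-algebra on `Z_ω` generated by the internal sets. -/
instance : MeasurableSpace (LoebSpace d ω) :=
  MeasurableSpace.generateFrom (Set.range (internalSet ω))

/-- The ultralimit of the normalized sizes `|A_k| / d_k`. -/
def intSize (ω : Ultrafilter ℕ) (A : ∀ k, Set (Fin (d k))) : ENNReal :=
  ulim ω (fun k => unif (d k) (A k))

theorem tendsto_intSize (A : ∀ k, Set (Fin (d k))) :
    Tendsto (fun k => unif (d k) (A k)) ω (𝓝 (intSize ω A)) := tendsto_ulim _ _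

/-- The least size of an internal set covering `S`. -/
def coverSize (ω : Ultrafilter ℕ) (S : Set (LoebSpace d ω)) : ENNReal :=
  ⨅ (A : ∀ k, Set (Fin (d k))) (_ : S ⊆ internalSet ω A), intSize ω A

theorem coverSize_empty : coverSize ω (∅ : Set (LoebSpace d ω)) = 0 := by
  refine le_antisymm ?_ bot_le
  refine (iInf₂_le (fun k => (∅ : Set (Fin (d k)))) (empty_subset _)).trans (le_of_eq ?_)
  refine tendsto_nhds_unique (tendsto_intSize (ω := ω) (d := d) (fun _ => ∅)) ?_
  simp

/-- The outer measure on `Z_ω` induced by the sizes of internal sets. -/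
def loebOuter (d : ℕ → ℕ) (ω : Ultrafilter ℕ) : OuterMeasure (LoebSpace d ω) :=
  OuterMeasure.ofFunction (coverSize ω) coverSize_empty

theorem le_caratheodory_loebOuter :
    (inferInstance : MeasurableSpace (LoebSpace d ω)) ≤ (loebOuter d ω).caratheodory := by
  refine MeasurableSpace.generateFrom_le ?_
  rintro _ ⟨B, rfl⟩
  refine OuterMeasure.ofFunction_caratheodory fun t => le_iInf₂ fun A hA => ?_
  have h1 : coverSize ω (t ∩ internalSet ω B) ≤ intSize ω (fun k => A k ∩ B k) := by
    refine iInf₂_le _ ?_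
    rintro z ⟨hz, hB⟩
    obtain ⟨j, rfl, h⟩ := hA hz
    rw [mk_mem_internalSet] at hB ⊢
    exact h.and hB
  have h2 : coverSize ω (t \ internalSet ω B) ≤ intSize ω (fun k => A k \ B k) := by
    refine iInf₂_le _ ?_
    rintro z ⟨hz, hB⟩
    obtain ⟨j, rfl, h⟩ := hA hz
    rw [mk_mem_internalSet] at hB ⊢
    exact h.and (Ultrafilter.eventually_not.2 hB)
  refine (add_le_add h1 h2).trans (le_of_eq ?_)
  refine tendsto_nhds_unique
    ((tendsto_intSize (ω := ω) (fun k => A k ∩ B k)).add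
      (tendsto_intSize (ω := ω) (fun k => A k \ B k))) ?_
  simp only [measure_inter_add_sdiff _ (MeasurableSet.of_discrete)]
  exact tendsto_intSize A

/-- The Loeb measure `u_ω`, the measure with `u_ω (∏_{k → ω} A_k) = lim_{k → ω} |A_k| / d_k`
(see `loebMeasure_internalSet`). -/
def loebMeasure (d : ℕ → ℕ) (ω : Ultrafilter ℕ) : Measure (LoebSpace d ω) :=
  (loebOuter d ω).toMeasure le_caratheodory_loebOuter

/-- The ultrafilter is free: it contains no finite set. -/
def IsFree (ω : Ultrafilter ℕ) : Prop := ∀ s : Set ℕ, s.Finite → s ∉ ω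

theorem IsFree.eventually_ge (hω : IsFree ω) (n : ℕ) : ∀ᶠ k in (ω : Filter ℕ), n ≤ k := by
  have h := Ultrafilter.compl_mem_iff_notMem.2 (hω _ (Set.finite_lt_nat n))
  refine mem_of_superset h fun k hk => ?_
  simpa using hk

theorem coverSize_iUnion_le (hω : IsFree ω) (S : ℕ → Set (LoebSpace d ω)) :
    coverSize ω (⋃ n, S n) ≤ ∑' n, coverSize ω (S n) := by
  refine ENNReal.le_of_forall_pos_le_add fun ε hε hfin => ?_
  have hε2 : ((ε : ENNReal) / 2) ≠ 0 := by simpa using hε.ne'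
  obtain ⟨δ, hδ, hδs⟩ := ENNReal.exists_pos_sum_of_countable hε2 ℕ
  have hA : ∀ n, ∃ A : ∀ k, Set (Fin (d k)), S n ⊆ internalSet ω A ∧
      intSize ω A ≤ coverSize ω (S n) + δ n := by
    intro n
    have hlt : coverSize ω (S n) < coverSize ω (S n) + δ n :=
      ENNReal.lt_add_right (ne_top_of_le_ne_top hfin.ne (ENNReal.le_tsum n)) (by
        simpa using (hδ n).ne')
    obtain ⟨A, hA⟩ := iInf_lt_iff.1 hlt
    obtain ⟨hS, hA⟩ := iInf_lt_iff.1 hA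
    exact ⟨A, hS, hA.le⟩
  choose A hAS hAc using hA
  set s : ENNReal := ∑' n, coverSize ω (S n) with hs
  let P : ℕ → ℕ → Prop := fun k n => unif (d k) (⋃ i ∈ Finset.range n, A i k) ≤ s + ε
  classical
  let N : ℕ → ℕ := fun k => Nat.findGreatest (P k) k
  let B : ∀ k, Set (Fin (d k)) := fun k => ⋃ i ∈ Finset.range (N k), A i k
  have hBle : ∀ k, unif (d k) (B k) ≤ s + ε := fun k =>
    Nat.findGreatest_spec (P := P k) (Nat.zero_le k) (by simp [P])
  have hP : ∀ n, ∀ᶠ k in (ω : Filter ℕ), P k n := by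
    intro n
    have hlim : Tendsto (fun k => ∑ i ∈ Finset.range n, unif (d k) (A i k)) ω
        (𝓝 (∑ i ∈ Finset.range n, intSize ω (A i))) :=
      tendsto_finsetSum _ fun i _ => tendsto_intSize (A i)
    have hlt : ∑ i ∈ Finset.range n, intSize ω (A i) < s + ε := by
      calc ∑ i ∈ Finset.range n, intSize ω (A i)
          ≤ ∑ i ∈ Finset.range n, (coverSize ω (S i) + δ i) :=
            Finset.sum_le_sum fun i _ => hAc i
        _ ≤ ∑' i, (coverSize ω (S i) + δ i) := ENNReal.sum_le_tsum _
        _ = s + ∑' i, (δ i : ENNReal) := ENNReal.tsum_add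
        _ ≤ s + (ε : ENNReal) / 2 := by gcongr
        _ < s + ε := by
          refine ENNReal.add_lt_add_left hfin.ne ?_
          exact ENNReal.half_lt_self (by simpa using hε.ne') ENNReal.coe_ne_top
    filter_upwards [hlim.eventually_lt_const hlt] with k hk
    exact (measure_biUnion_finset_le _ _).trans hk.le
  have hcov : (⋃ n, S n) ⊆ internalSet ω B := by
    refine iUnion_subset fun n z hz => ?_
    obtain ⟨j, rfl, h⟩ := hAS n hz
    rw [mk_mem_internalSet]
    filter_upwards [h, hP (n + 1), hω.eventually_ge (n + 1)] with k h1 h2 h3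
    have : n + 1 ≤ N k := Nat.le_findGreatest h3 h2
    exact mem_biUnion (Finset.mem_range.2 this) h1
  exact (iInf₂_le B hcov).trans (le_of_tendsto' (tendsto_intSize B) hBle)

theorem coverSize_mono {S T : Set (LoebSpace d ω)} (h : S ⊆ T) : coverSize ω S ≤ coverSize ω T :=
  le_iInf₂ fun A hA => iInf₂_le A (h.trans hA)

theorem coverSize_internalSet (hd : ∀ k, 0 < d k) (A : ∀ k, Set (Fin (d k))) :
    coverSize ω (internalSet ω A) = intSize ω A := by
  refine le_antisymm (iInf₂_le A Subset.rfl) (le_iInf₂ fun B hB => ?_)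
  refine le_of_tendsto_of_tendsto (tendsto_intSize A) (tendsto_intSize B) ?_
  suffices h : ∀ᶠ k in (ω : Filter ℕ), A k ⊆ B k from h.mono fun k hk => measure_mono hk
  by_contra hcon
  rw [← Ultrafilter.eventually_not] at hcon
  have hex : ∀ k, ∃ j : Fin (d k), ¬ A k ⊆ B k → j ∈ A k ∧ j ∉ B k := by
    intro k
    by_cases h : A k ⊆ B k
    · exact ⟨⟨0, hd k⟩, fun h' => absurd h h'⟩
    · obtain ⟨j, hj⟩ := Set.not_subset.1 h
      exact ⟨j, fun _ => hj⟩
  choose j hj using hex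
  have h1 : LoebSpace.mk ω j ∈ internalSet ω A :=
    mk_mem_internalSet.2 (hcon.mono fun k hk => (hj k hk).1)
  have h2 := (mk_mem_internalSet.1 (hB h1)).and hcon
  obtain ⟨k, hk1, hk2⟩ := h2.exists
  exact (hj k hk2).2 hk1

/-- The characteristic property of the Loeb measure. -/
theorem loebMeasure_internalSet (hω : IsFree ω) (hd : ∀ k, 0 < d k)
    (A : ∀ k, Set (Fin (d k))) :
    loebMeasure d ω (internalSet ω A) = intSize ω A := by
  have hA : MeasurableSet (internalSet ω A) := MeasurableSpace.measurableSet_generateFrom ⟨A, rfl⟩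
  rw [loebMeasure, toMeasure_apply _ _ hA,
    loebOuter, OuterMeasure.ofFunction_eq _ (fun _ h => coverSize_mono h)
      (coverSize_iUnion_le hω), coverSize_internalSet hd]

theorem isProbabilityMeasure_loebMeasure (hω : IsFree ω) (hd : ∀ k, 0 < d k) :
    IsProbabilityMeasure (loebMeasure d ω) := by
  constructor
  have h : (Set.univ : Set (LoebSpace d ω)) = internalSet ω (fun _ => Set.univ) := by
    refine (Set.eq_univ_of_forall fun z => ?_).symm
    obtain ⟨j, rfl⟩ := z.exists_mk
    exact ⟨j, rfl, by simp⟩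
  rw [h, loebMeasure_internalSet hω hd]
  refine tendsto_nhds_unique (tendsto_intSize (ω := ω) (d := d) (fun _ => Set.univ)) ?_
  have : ∀ k, unif (d k) Set.univ = 1 := fun k => by
    have : Nonempty (Fin (d k)) := ⟨⟨0, hd k⟩⟩
    exact (isProbabilityMeasure_uniformOn Set.finite_univ Set.univ_nonempty).measure_univ
  simp [this]

/-- The map `(f_k)_{k → ω} : Z_ω → K`, `(j_k)_{k → ω} ↦ lim_{k → ω} f_k (j_k)`. -/
def ulimMap {K : Type*} [TopologicalSpace K] (ω : Ultrafilter ℕ) (f : ∀ k, Fin (d k) → K)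
    (z : LoebSpace d ω) : K :=
  Quotient.liftOn z (fun j => ulim ω (fun k => f k (j k))) fun i j hij => by
    have : ω.map (fun k => f k (i k)) = ω.map (fun k => f k (j k)) :=
      Ultrafilter.coe_injective
        (Filter.map_congr ((show ∀ᶠ k in (ω : Filter ℕ), i k = j k from hij).mono
          fun k hk => by simp only [hk]))
    simp only [ulim, this]

/-! ### The metric ultraproduct of the symmetric groups and its action on `Z_ω` -/

theorem hamm_conj {n : ℕ} (p q : Equiv.Perm (Fin n)) : hamm (q * p * q⁻¹) 1 = hamm p 1 := by
  have h : {j | (q * p * q⁻¹) j ≠ (1 : Equiv.Perm (Fin n)) j} =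
      q '' {j | p j ≠ (1 : Equiv.Perm (Fin n)) j} := by
    ext j
    rw [q.image_eq_preimage_symm]
    simp only [mem_ofPred_eq, mem_preimage, Equiv.Perm.mul_apply, Equiv.Perm.one_apply, ne_eq,
      ← Equiv.Perm.inv_def, Equiv.Perm.eq_inv_iff_eq]
  rcases Nat.eq_zero_or_pos n with rfl | hn
  · simp only [hamm, Set.eq_empty_of_isEmpty, measure_empty]
  have : Nonempty (Fin n) := ⟨⟨0, hn⟩⟩
  rw [hamm, hamm, unif, h, uniformOn_univ, uniformOn_univ,
    Measure.count_injective_image q.injective]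

/-- The normal subgroup of sequences `(p_k)_k` of permutations with
`lim_{k → ω} d_Hamm(p_k, id) = 0`. -/
def nullSeq (d : ℕ → ℕ) (ω : Ultrafilter ℕ) : Subgroup (∀ k, Equiv.Perm (Fin (d k))) where
  carrier := {p | Tendsto (fun k => hamm (p k) 1) ω (𝓝 0)}
  one_mem' := by simp [hamm]
  mul_mem' := by
    intro p q hp hq
    have h := Tendsto.add hp hq
    rw [add_zero] at h
    refine tendsto_of_tendsto_of_tendsto_of_le_of_le tendsto_const_nhds h (fun _ => bot_le) ?_
    intro k
    refine (measure_mono ?_).trans (measure_union_le _ _)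
    intro j hj
    by_contra hcon
    simp only [mem_union, mem_ofPred_eq, not_or, not_not, Equiv.Perm.one_apply] at hcon
    simp [hcon.1, hcon.2] at hj
  inv_mem' := by
    intro p hp
    refine (Tendsto.congr (fun k => ?_) hp)
    refine congrArg _ (Set.ext fun j => ?_)
    simp only [mem_ofPred_eq, Pi.inv_apply, Equiv.Perm.one_apply, ne_eq,
      Equiv.Perm.inv_eq_iff_eq]
    exact not_congr eq_comm

instance : (nullSeq d ω).Normal where
  conj_mem := by
    intro p hp q
    refine Tendsto.congr (fun k => ?_) hp
    exact (hamm_conj (p k) (q k)).symm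

/-- The metric ultraproduct `∏_{k → ω} S_{d_k}`. -/
abbrev UltraSym (d : ℕ → ℕ) (ω : Ultrafilter ℕ) : Type :=
  (∀ k, Equiv.Perm (Fin (d k))) ⧸ nullSeq d ω

/-- The map `z ↦ (p_k)_{k → ω} z` on `Z_ω`, for a chosen representative `(p_k)_k`; up to null sets
it only depends on the class of `(p_k)_k` in `∏_{k → ω} S_{d_k}` (see `permAct_ae_eq`). -/
def permAct (ω : Ultrafilter ℕ) (p : ∀ k, Equiv.Perm (Fin (d k))) (z : LoebSpace d ω) :
    LoebSpace d ω :=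
  Quotient.map (sa := productSetoid _ _) (sb := productSetoid _ _)
    (fun (j : ∀ k, Fin (d k)) k => p k (j k))
    (fun _ _ h => h.mono fun k hk => congrArg (p k) hk) z

theorem permAct_ae_eq (hω : IsFree ω) (hd : ∀ k, 0 < d k) {p q : ∀ k, Equiv.Perm (Fin (d k))}
    (h : (p : UltraSym d ω) = (q : UltraSym d ω)) :
    permAct ω p =ᵐ[loebMeasure d ω] permAct ω q := by
  have h1 : Tendsto (fun k => hamm ((p⁻¹ * q) k) 1) ω (𝓝 0) := QuotientGroup.eq.1 h
  have h2 : loebMeasure d ω (internalSet ω fun k => {j | (p⁻¹ * q) k j ≠ j}) = 0 := by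
    rw [loebMeasure_internalSet hω hd]
    exact tendsto_nhds_unique (tendsto_intSize _) h1
  refine measure_mono_null (fun z hz => ?_) h2
  obtain ⟨j, rfl⟩ := z.exists_mk
  refine mk_mem_internalSet.2 ?_
  have hz' : ¬ ∀ᶠ k in (ω : Filter ℕ), p k (j k) = q k (j k) := fun hh =>
    hz (LoebSpace.mk_eq_mk.2 hh)
  rw [← Ultrafilter.eventually_not] at hz'
  refine hz'.mono fun k hk hk' => hk ?_
  have h3 : (p k)⁻¹ (q k (j k)) = j k := hk'
  rw [Equiv.Perm.inv_eq_iff_eq] at h3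
  exact h3.symm

variable {G : Type*} [Group G]

/-- The map `σ_ω : G → ∏_{k → ω} S_{d_k}`, `σ_ω(g) = (σ_k(g))_{k → ω}`. -/
def sigmaOmega (ω : Ultrafilter ℕ) (σ : ∀ k, G → Equiv.Perm (Fin (d k))) (g : G) :
    UltraSym d ω :=
  ((fun k => σ k g : ∀ k, Equiv.Perm (Fin (d k))) : UltraSym d ω)

/-- The centralizer `G'_ω` of `σ_ω(G)` in `∏_{k → ω} S_{d_k}`. -/
def soficCentralizer (ω : Ultrafilter ℕ) (σ : ∀ k, G → Equiv.Perm (Fin (d k))) :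
    Subgroup (UltraSym d ω) :=
  Subgroup.centralizer (Set.range (sigmaOmega ω σ))

/-- The action of `G'_ω` on `(Z_ω, u_ω)` is ergodic: a measurable set that is invariant, up to
null sets, under every element of `G'_ω` is null or conull. -/
def HasErgodicCentralizer (ω : Ultrafilter ℕ) (σ : ∀ k, G → Equiv.Perm (Fin (d k))) : Prop :=
  ∀ A : Set (LoebSpace d ω), MeasurableSet A →
    (∀ p : ∀ k, Equiv.Perm (Fin (d k)), (p : UltraSym d ω) ∈ soficCentralizer ω σ →
      permAct ω p ⁻¹' A =ᵐ[loebMeasure d ω] A) →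
    loebMeasure d ω A = 0 ∨ loebMeasure d ω Aᶜ = 0

/-! ### Topological microstates and absorption -/

section Dynamics

variable {X : Type*} [TopologicalSpace X] [MeasurableSpace X] [SMul G X]

/-- A topological microstate on `Z_ω`: a measurable, almost surely `G`-equivariant map
`Z_ω → X`. -/
def IsTopMicrostate (ω : Ultrafilter ℕ) (σ : ∀ k, G → Equiv.Perm (Fin (d k)))
    (Φ : LoebSpace d ω → X) : Prop :=
  Measurable Φ ∧ ∀ g : G, ∀ᵐ z ∂(loebMeasure d ω), Φ (permAct ω (fun k => σ k g) z) = g • Φ z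

/-- The subset `Y` of `X` absorbs all topological microstates. -/
def Absorbs (ω : Ultrafilter ℕ) (σ : ∀ k, G → Equiv.Perm (Fin (d k))) (Y : Set X) : Prop :=
  ∀ Φ : LoebSpace d ω → X, IsTopMicrostate ω σ Φ → ∀ᵐ z ∂(loebMeasure d ω), Φ z ∈ Y

/-! ### Measures on microstates and local weak* limits -/

/-- The sequence `μ_k ∈ Prob(X^{d_k})` is asymptotically supported on topological microstates as
`k → ω`. -/
def AsympSupported (ω : Ultrafilter ℕ) (σ : ∀ k, G → Equiv.Perm (Fin (d k)))
    (μ : ∀ k, ProbabilityMeasure (Fin (d k) → X)) : Prop :=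
  ∀ (g : G) (U : Set (X × X)), IsOpen U → Set.diagonal X ⊆ U → ∀ ε : ENNReal, 0 < ε →
    Tendsto (fun k => (μ k : Measure (Fin (d k) → X))
      {φ | 1 - ε < unif (d k) {j | (φ (σ k g j), g • φ j) ∈ U}}) ω (𝓝 1)

/-- The marginal `(ℰ_j)_* μ` of `μ ∈ Prob(X^n)` on the `j`-th coordinate. -/
def marginal {n : ℕ} (μ : ProbabilityMeasure (Fin n → X)) (j : Fin n) : ProbabilityMeasure X :=
  μ.map (f := fun x => x j) (measurable_pi_apply j).aemeasurable

/-- Local weak* convergence of `μ_k ∈ Prob(X^{d_k})` to `m ∈ Prob(X)` as `k → ω`. -/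
def LocallyWeakStarTendsto [OpensMeasurableSpace X] (ω : Ultrafilter ℕ)
    (μ : ∀ k, ProbabilityMeasure (Fin (d k) → X)) (m : ProbabilityMeasure X) : Prop :=
  ∀ O ∈ 𝓝 m, Tendsto (fun k => unif (d k) {j | marginal (μ k) j ∈ O}) ω (𝓝 1)

/-- `m` is the local weak* limit of a sequence `μ_k ∈ Prob(X^{d_k})` which is asymptotically
supported on topological microstates. -/
def IsLocalWeakStarLimit [OpensMeasurableSpace X] (ω : Ultrafilter ℕ)
    (σ : ∀ k, G → Equiv.Perm (Fin (d k))) (m : ProbabilityMeasure X) : Prop :=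
  ∃ μ : ∀ k, ProbabilityMeasure (Fin (d k) → X),
    AsympSupported ω σ μ ∧ LocallyWeakStarTendsto ω μ m

/-- The map `ℰ((μ_k)_k) : Z_ω → Prob(X)`, the ultralimit of the marginals. -/
def marginalLimit [OpensMeasurableSpace X] (ω : Ultrafilter ℕ)
    (μ : ∀ k, ProbabilityMeasure (Fin (d k) → X)) : LoebSpace d ω → ProbabilityMeasure X :=
  ulimMap ω (fun k => marginal (μ k))

/-- The space `ℒ_ω(G ↷ X) ⊆ Meas(Z_ω, Prob(X))` of generalized local weak* limits. -/
def genLimits [OpensMeasurableSpace X] (ω : Ultrafilter ℕ)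
    (σ : ∀ k, G → Equiv.Perm (Fin (d k))) :
    Set (LoebSpace d ω →ₘ[loebMeasure d ω] ProbabilityMeasure X) :=
  {f | ∃ μ : ∀ k, ProbabilityMeasure (Fin (d k) → X),
    AsympSupported ω σ μ ∧ f =ᵐ[loebMeasure d ω] marginalLimit ω μ}

end Dynamics

/-! ### Closed subgroups and their Haar measures -/

section Groups

/-- The normalized Haar measure of a compact group. -/
def haarProb (K : Type*) [Group K] [TopologicalSpace K] [IsTopologicalGroup K] [CompactSpace K]
    [MeasurableSpace K] [BorelSpace K] : ProbabilityMeasure K :=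
  ⟨Measure.haarMeasure ⊤, ⟨Measure.haarMeasure_self⟩⟩

variable {X : Type*} [Group X] [TopologicalSpace X] [IsTopologicalGroup X] [CompactSpace X]

/-- A closed subgroup of a compact group, as a nonempty compact set. -/
def toNonemptyCompacts (H : ClosedSubgroup X) : TopologicalSpace.NonemptyCompacts X where
  carrier := H
  isCompact' := H.isClosed'.isCompact
  nonempty' := ⟨1, one_mem H⟩

/-- The topology of `Sub(X)`, as a subspace of the space of nonempty compact subsets of `X` with
the Vietoris topology, which is the topology of any Hausdorff metric when `X` is metrizable. -/
instance : TopologicalSpace (ClosedSubgroup X) :=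
  TopologicalSpace.induced toNonemptyCompacts inferInstance

variable [MeasurableSpace X] [BorelSpace X]

/-- The Haar measure `m_H` of a closed subgroup `H`, as a Borel probability measure on `X`. -/
def haarSub (H : ClosedSubgroup X) : ProbabilityMeasure X :=
  haveI : IsTopologicalGroup H := inferInstanceAs (IsTopologicalGroup H.toSubgroup)
  (haarProb H).map (f := fun x : H => (x : X)) measurable_subtype_coe.aemeasurable

/-- The poset `𝒮_ω(G ↷ X)` of all `Y ∈ Meas(Z_ω, Sub(X))` with `m_Y ∈ ℒ_ω(G ↷ X)`, ordered by
almost everywhere inclusion. -/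
def genSubgroups [SMul G X] (ω : Ultrafilter ℕ) (σ : ∀ k, G → Equiv.Perm (Fin (d k))) :
    Set (LoebSpace d ω →ₘ[loebMeasure d ω] ClosedSubgroup X) :=
  {Y | ∃ f ∈ genLimits (X := X) ω σ, f =ᵐ[loebMeasure d ω] fun z => haarSub (Y z)}

/-- The closed subgroup `H` is `G`-invariant. -/
def GInvariant (G : Type*) [SMul G X] (H : ClosedSubgroup X) : Prop :=
  ∀ (g : G), ∀ x ∈ H, g • x ∈ H

end Groups

end SoficAlg

end

/-! Let `M` be the set of topological microstates. Since `G` acts by automorphisms, `M` is closed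
under pointwise products, and it is closed under composition with elements of the centralizer. Let
`Y` be the intersection of all closed subgroups that absorb `M` (`absorbingSubgroup`). By second
countability a countable subfamily has the same intersection, so `Y` itself absorbs; it is
`G`-invariant because `Φ ∘ σ_ω(g) = gΦ` and `σ_ω(g)` preserves `u_ω`.

Upper bound (`ae_marginalLimit_mem`): every limit of marginals is concentrated on `Y` at almost
every point. Otherwise averaging over `μ_k` produces single approximate microstates `φ_k` with a
fixed positive proportion of coordinates at a fixed distance from `Y`, and the ultralimit of the
`φ_k` is a microstate that leaves `Y` on a set of positive measure. Since the support of `m_H` is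
`H`, this bounds every competing subgroup by `Y`.

Lower bound (`isLocalWeakStarLimit_absorbingSubgroup`): `m_Y` is a local weak* limit. This is where
ergodicity enters. For a continuous vector-valued `f` on `X`, with class `ξ` in `L²(X)`, consider
the maps `z ↦ Φ(z) • ξ`, `Φ ∈ M`, in `L²(Z_ω, L²(X))`. The element of least norm in their closed
convex hull is fixed by composition with the centralizer, hence is a constant `w`; it is also fixed
by pointwise action of `M`, hence `w` is fixed by `Y`. Pairing with `Y`-fixed vectors identifies `w`
with `∫ y • ξ dm_Y(y)`. So suitable convex combinations `∑ c_i f(Φ_i(z))` are close to `∫ f dm_Y`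
for most `z` (`exists_convexCombination_close_haarSub`). Lifting each `Φ_i` to a sequence of finite
maps (`exists_lift`) and taking the same convex combination of point masses at the lifts gives
measures whose marginals are mostly near `m_Y`; a diagonal argument finishes. -/

namespace SoficAlg

/-! ### Loeb measure theory: diagonal arguments, internal approximation and lifting of maps. -/

section

variable {d : ℕ → ℕ} {ω : Ultrafilter ℕ}

/-- Diagonalization along a free ultrafilter. -/
theorem IsFree.exists_diagonal (hω : IsFree ω) {P : ℕ → ℕ → Prop}
    (h : ∀ n, ∀ᶠ k in (ω : Filter ℕ), P k n) :
    ∃ N : ℕ → ℕ, Tendsto N ω atTop ∧ ∀ᶠ k in (ω : Filter ℕ), P k (N k) := by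
  classical
  refine ⟨fun k => Nat.findGreatest (P k) k, tendsto_atTop.2 fun n => ?_, ?_⟩
  · filter_upwards [h n, hω.eventually_ge n] with k h1 h2
    exact Nat.le_findGreatest h2 h1
  -- `Nat.findGreatest` returns `0` when nothing is found, so `P k 0` is what guarantees `P k (N
  -- k)`.
  · filter_upwards [h 0] with k h0
    exact Nat.findGreatest_spec (P := P k) (Nat.zero_le k) h0

theorem IsFree.exists_diagonal_seq (hω : IsFree ω) {α : ℕ → Type*} [∀ k, Nonempty (α k)]
    {Q : ∀ k, ℕ → α k → Prop} (h : ∀ n, ∀ᶠ k in (ω : Filter ℕ), ∃ a, Q k n a) :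
    ∃ (N : ℕ → ℕ) (a : ∀ k, α k), Tendsto N ω atTop ∧
      ∀ᶠ k in (ω : Filter ℕ), Q k (N k) (a k) := by
  obtain ⟨N, hN, hP⟩ := hω.exists_diagonal h
  exact ⟨N, fun k => Classical.epsilon (Q k (N k)), hN, hP.mono fun k => Classical.epsilon_spec⟩

theorem tendsto_inv_nat_add_one :
    Tendsto (fun n : ℕ => ((n : ENNReal) + 1)⁻¹) atTop (𝓝 0) := by
  have := (tendsto_add_atTop_iff_nat 1).2 ENNReal.tendsto_inv_nat_nhds_zero
  simpa using this

/-! ### Internal sets -/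

theorem measurableSet_internalSet (A : ∀ k, Set (Fin (d k))) :
    MeasurableSet (internalSet ω A) :=
  MeasurableSpace.measurableSet_generateFrom ⟨A, rfl⟩

theorem internalSet_mono {A B : ∀ k, Set (Fin (d k))}
    (h : ∀ᶠ k in (ω : Filter ℕ), A k ⊆ B k) : internalSet ω A ⊆ internalSet ω B := by
  rintro z ⟨j, rfl, hj⟩
  exact ⟨j, rfl, by filter_upwards [h, hj] with k h1 h2 using h1 h2⟩

theorem internalSet_inter (A B : ∀ k, Set (Fin (d k))) :
    internalSet ω A ∩ internalSet ω B = internalSet ω fun k => A k ∩ B k := by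
  ext z
  obtain ⟨j, rfl⟩ := z.exists_mk
  simp only [mem_inter_iff, mk_mem_internalSet, eventually_and]

theorem compl_internalSet (A : ∀ k, Set (Fin (d k))) :
    (internalSet ω A)ᶜ = internalSet ω fun k => (A k)ᶜ := by
  ext z
  obtain ⟨j, rfl⟩ := z.exists_mk
  simp only [mem_compl_iff, mk_mem_internalSet, Ultrafilter.eventually_not]

theorem tendsto_unif_internalSet (hω : IsFree ω) (hd : ∀ k, 0 < d k)
    (A : ∀ k, Set (Fin (d k))) :
    Tendsto (fun k => unif (d k) (A k)) ω (𝓝 (loebMeasure d ω (internalSet ω A))) := by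
  rw [loebMeasure_internalSet hω hd]
  exact tendsto_intSize A

theorem isProbabilityMeasure_unif {n : ℕ} (hn : 0 < n) : IsProbabilityMeasure (unif n) :=
  have : Nonempty (Fin n) := ⟨⟨0, hn⟩⟩
  isProbabilityMeasure_uniformOn Set.finite_univ Set.univ_nonempty

/-- Every measurable set is internal up to a null set. -/
theorem exists_internalSet_ae_eq (hω : IsFree ω) (hd : ∀ k, 0 < d k) {S : Set (LoebSpace d ω)}
    (hS : MeasurableSet S) :
    ∃ A : ∀ k, Set (Fin (d k)), S =ᵐ[loebMeasure d ω] internalSet ω A := by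
  have := isProbabilityMeasure_loebMeasure hω hd
  induction S, hS using MeasurableSpace.generateFrom_induction with
  | hC t ht _ =>
    obtain ⟨A, rfl⟩ := ht
    exact ⟨A, ae_eq_refl _⟩
  | empty => exact ⟨fun _ => ∅, by
      have : internalSet ω (fun k => (∅ : Set (Fin (d k)))) = ∅ := by
        ext z
        obtain ⟨j, rfl⟩ := z.exists_mk
        rw [mk_mem_internalSet]
        exact iff_of_false (fun h => h.exists.elim fun _ => id) id
      rw [this]
      exact ae_eq_refl _⟩
  | compl t _ ih =>
    obtain ⟨A, hA⟩ := ih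
    exact ⟨fun k => (A k)ᶜ, by rw [← compl_internalSet]; exact hA.compl⟩
  | iUnion t _ ih =>
    choose A hA using ih
    have hU : (⋃ n, t n) =ᵐ[loebMeasure d ω] ⋃ n, internalSet ω (A n) :=
      Filter.EventuallyEq.countable_iUnion hA
    set s := loebMeasure d ω (⋃ n, internalSet ω (A n)) with hs
    -- The internal set sought is a union of the first `N k` sets `A i k`. With `N` unbounded along
    -- `ω` it contains every `internalSet ω (A n)`; the size bound keeps `N` slow enough for its
    -- measure not to exceed `s`.
    have hP : ∀ n, ∀ᶠ k in (ω : Filter ℕ),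
        unif (d k) (⋃ i ∈ Finset.range n, A i k) ≤ s + ((n : ENNReal) + 1)⁻¹ := by
      intro n
      have h1 : internalSet ω (fun k => ⋃ i ∈ Finset.range n, A i k) ⊆
          ⋃ i, internalSet ω (A i) := by
        intro z hz
        obtain ⟨j, rfl⟩ := z.exists_mk
        rw [mk_mem_internalSet] at hz
        simp only [mem_iUnion, exists_prop] at hz
        by_contra hcon
        simp only [mem_iUnion, not_exists, mk_mem_internalSet] at hcon
        have h2 : ∀ᶠ k in (ω : Filter ℕ), ∀ i ∈ Finset.range n, ¬ j k ∈ A i k :=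
          (Finset.eventually_all _).2 fun i _ => Ultrafilter.eventually_not.2 (hcon i)
        obtain ⟨k, ⟨i, hi, hk⟩, hk'⟩ := (hz.and h2).exists
        exact hk' i hi hk
      have h2 := tendsto_unif_internalSet hω hd (ω := ω)
        (fun k => ⋃ i ∈ Finset.range n, A i k)
      have h3 : loebMeasure d ω (internalSet ω (fun k => ⋃ i ∈ Finset.range n, A i k)) <
          s + ((n : ENNReal) + 1)⁻¹ :=
        (measure_mono h1).trans_lt (ENNReal.lt_add_right (measure_ne_top _ _) (by simp))
      exact (h2.eventually_lt_const h3).mono fun k hk => hk.le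
    obtain ⟨N, hN, hNP⟩ := hω.exists_diagonal hP
    refine ⟨fun k => ⋃ i ∈ Finset.range (N k), A i k, hU.trans ?_⟩
    refine ae_eq_of_subset_of_measure_ge (iUnion_subset fun n => internalSet_mono ?_) ?_
      (MeasurableSet.iUnion fun n => measurableSet_internalSet _).nullMeasurableSet
      (measure_ne_top _ _)
    · filter_upwards [hN.eventually_ge_atTop (n + 1)] with k hk
      exact subset_biUnion_of_mem (u := fun i => A i k) (by simpa using hk)
    · have h4 : Tendsto (fun k => s + ((N k : ENNReal) + 1)⁻¹) ω (𝓝 (s + 0)) := by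
        refine tendsto_const_nhds.add ?_
        exact tendsto_inv_nat_add_one.comp hN
      rw [add_zero] at h4
      exact le_of_tendsto_of_tendsto (tendsto_unif_internalSet hω hd _) h4 hNP

/-! ### The action of sequences of permutations -/

theorem permAct_mk (p : ∀ k, Equiv.Perm (Fin (d k))) (j : ∀ k, Fin (d k)) :
    permAct ω p (LoebSpace.mk ω j) = LoebSpace.mk ω fun k => p k (j k) := rfl

theorem permAct_mul (p q : ∀ k, Equiv.Perm (Fin (d k))) (z : LoebSpace d ω) :
    permAct ω (p * q) z = permAct ω p (permAct ω q z) := by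
  obtain ⟨j, rfl⟩ := z.exists_mk
  rfl

theorem permAct_preimage_internalSet (p : ∀ k, Equiv.Perm (Fin (d k)))
    (A : ∀ k, Set (Fin (d k))) :
    permAct ω p ⁻¹' internalSet ω A = internalSet ω fun k => p k ⁻¹' A k := by
  ext z
  obtain ⟨j, rfl⟩ := z.exists_mk
  simp only [mem_preimage, permAct_mk, mk_mem_internalSet]

theorem measurable_permAct (p : ∀ k, Equiv.Perm (Fin (d k))) : Measurable (permAct ω p) := by
  refine measurable_generateFrom ?_
  rintro _ ⟨A, rfl⟩
  rw [permAct_preimage_internalSet]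
  exact measurableSet_internalSet _

theorem unif_preimage {n : ℕ} (p : Equiv.Perm (Fin n)) (A : Set (Fin n)) :
    unif n (p ⁻¹' A) = unif n A := by
  rcases Nat.eq_zero_or_pos n with rfl | hn
  · simp only [Set.eq_empty_of_isEmpty, measure_empty]
  have : Nonempty (Fin n) := ⟨⟨0, hn⟩⟩
  rw [unif, uniformOn_univ, uniformOn_univ, ← p.image_symm_eq_preimage,
    Measure.count_injective_image p.symm.injective]

theorem measurePreserving_permAct (hω : IsFree ω) (hd : ∀ k, 0 < d k)
    (p : ∀ k, Equiv.Perm (Fin (d k))) :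
    MeasurePreserving (permAct ω p) (loebMeasure d ω) (loebMeasure d ω) := by
  have := isProbabilityMeasure_loebMeasure hω hd
  have := Measure.isProbabilityMeasure_map (μ := loebMeasure d ω)
    (measurable_permAct p).aemeasurable
  refine ⟨measurable_permAct p, ?_⟩
  refine ext_of_generate_finite _ rfl ?_ ?_ (by simp)
  · rintro _ ⟨A, rfl⟩ _ ⟨B, rfl⟩ _
    exact ⟨_, (internalSet_inter A B).symm⟩
  · rintro _ ⟨A, rfl⟩
    rw [Measure.map_apply (measurable_permAct p) (measurableSet_internalSet A),
      permAct_preimage_internalSet, loebMeasure_internalSet hω hd, loebMeasure_internalSet hω hd]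
    simp only [intSize, unif_preimage]

/-! ### Ultralimits of maps -/

section UlimMap

variable {K L : Type*} [TopologicalSpace K] [CompactSpace K] [TopologicalSpace L]

theorem tendsto_ulimMap (f : ∀ k, Fin (d k) → K) (j : ∀ k, Fin (d k)) :
    Tendsto (fun k => f k (j k)) ω (𝓝 (ulimMap ω f (LoebSpace.mk ω j))) :=
  tendsto_ulim ω fun k => f k (j k)

theorem ulim_eq [T2Space K] {x : ℕ → K} {a : K} (h : Tendsto x ω (𝓝 a)) : ulim ω x = a :=
  tendsto_nhds_unique (tendsto_ulim ω x) h

theorem internalSet_subset_ulimMap_preimage (f : ∀ k, Fin (d k) → K) {C : Set K}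
    (hC : IsClosed C) : internalSet ω (fun k => f k ⁻¹' C) ⊆ ulimMap ω f ⁻¹' C := by
  rintro z ⟨j, rfl, hj⟩
  exact hC.mem_of_tendsto (tendsto_ulimMap f j) hj

theorem ulimMap_preimage_subset_internalSet (f : ∀ k, Fin (d k) → K) {O : Set K}
    (hO : IsOpen O) : ulimMap ω f ⁻¹' O ⊆ internalSet ω (fun k => f k ⁻¹' O) := by
  intro z hz
  obtain ⟨j, rfl⟩ := z.exists_mk
  exact ⟨j, rfl, (tendsto_ulimMap f j).eventually (hO.mem_nhds hz)⟩

theorem ulimMap_comp [CompactSpace L] [T2Space L] (f : ∀ k, Fin (d k) → K) {g : K → L}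
    (hg : Continuous g) (z : LoebSpace d ω) :
    ulimMap ω (fun k j => g (f k j)) z = g (ulimMap ω f z) := by
  obtain ⟨j, rfl⟩ := z.exists_mk
  exact ulim_eq ((hg.tendsto _).comp (tendsto_ulimMap f j))

theorem ulimMap_prod [CompactSpace L] [T2Space K] [T2Space L] (f : ∀ k, Fin (d k) → K)
    (g : ∀ k, Fin (d k) → L) (z : LoebSpace d ω) :
    ulimMap ω (fun k j => (f k j, g k j)) z = (ulimMap ω f z, ulimMap ω g z) := by
  obtain ⟨j, rfl⟩ := z.exists_mk
  exact ulim_eq ((tendsto_ulimMap f j).prodMk_nhds (tendsto_ulimMap g j))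

theorem ulimMap_pi {ι : Type*} {K : ι → Type*} [∀ i, TopologicalSpace (K i)]
    [∀ i, CompactSpace (K i)] [∀ i, T2Space (K i)] (f : ∀ k, Fin (d k) → ∀ i, K i)
    (z : LoebSpace d ω) :
    ulimMap ω f z = fun i => ulimMap ω (fun k j => f k j i) z := by
  obtain ⟨j, rfl⟩ := z.exists_mk
  exact ulim_eq (tendsto_pi_nhds.2 fun i => tendsto_ulimMap (fun k j => f k j i) j)

omit [CompactSpace K] in
theorem ulimMap_permAct (f : ∀ k, Fin (d k) → K) (p : ∀ k, Equiv.Perm (Fin (d k)))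
    (z : LoebSpace d ω) :
    ulimMap ω f (permAct ω p z) = ulimMap ω (fun k j => f k (p k j)) z := by
  obtain ⟨j, rfl⟩ := z.exists_mk
  rfl

omit [CompactSpace K] in
/-- A closed set in a metrizable space is the intersection of a sequence of closed
neighbourhoods. -/
theorem exists_seq_closed_nhds [TopologicalSpace.MetrizableSpace K] {C : Set K}
    (hC : IsClosed C) : ∃ (O F : ℕ → Set K), (∀ n, IsOpen (O n)) ∧ (∀ n, IsClosed (F n)) ∧
      (∀ n, C ⊆ O n) ∧ (∀ n, O n ⊆ F n) ∧ ⋂ n, F n = C := by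
  let _ := TopologicalSpace.metrizableSpaceMetric K
  rcases C.eq_empty_or_nonempty with rfl | hne
  · exact ⟨fun _ => ∅, fun _ => ∅, by simp [iInter_const]⟩
  refine ⟨fun n => {x | Metric.infDist x C < 1 / ((n : ℝ) + 1)},
    fun n => {x | Metric.infDist x C ≤ 1 / ((n : ℝ) + 1)},
    fun n => isOpen_lt (Metric.continuous_infDist_pt C) continuous_const,
    fun n => isClosed_le (Metric.continuous_infDist_pt C) continuous_const, ?_, ?_, ?_⟩
  · intro n x hx
    rw [mem_ofPred_eq, Metric.infDist_zero_of_mem hx]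
    positivity
  · intro n x hx
    simp only [mem_ofPred_eq] at hx ⊢
    exact hx.le
  · refine Subset.antisymm (fun x hx => ?_) (fun x hx => ?_)
    · rw [mem_iInter] at hx
      rw [hC.mem_iff_infDist_zero hne]
      exact le_antisymm (ge_of_tendsto' tendsto_one_div_add_atTop_nhds_zero_nat hx)
        Metric.infDist_nonneg
    · refine mem_iInter.2 fun n => ?_
      rw [mem_ofPred_eq, Metric.infDist_zero_of_mem hx]
      positivity

/-- Membership passes from the sequence to the ultralimit for closed sets, and from the ultralimit
to the sequence for open ones. Interleaving open and closed neighbourhoods of `C` makes its preimage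
a countable intersection of internal sets, which yields measurability. -/
theorem ulimMap_preimage_eq_iInter (f : ∀ k, Fin (d k) → K) {C : Set K} {O F : ℕ → Set K}
    (hO : ∀ n, IsOpen (O n)) (hF : ∀ n, IsClosed (F n)) (hCO : ∀ n, C ⊆ O n)
    (hOF : ∀ n, O n ⊆ F n) (hFC : ⋂ n, F n = C) :
    ulimMap ω f ⁻¹' C = ⋂ n, internalSet ω fun k => f k ⁻¹' O n := by
  refine Subset.antisymm (subset_iInter fun n => ?_) fun z hz => ?_
  · exact (preimage_mono (hCO n)).trans (ulimMap_preimage_subset_internalSet f (hO n))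
  · rw [mem_preimage, ← hFC]
    refine mem_iInter.2 fun n => internalSet_subset_ulimMap_preimage f (hF n) ?_
    exact internalSet_mono (Eventually.of_forall fun k => preimage_mono (hOF n))
      (mem_iInter.1 hz n)

theorem measurable_ulimMap [TopologicalSpace.MetrizableSpace K] [MeasurableSpace K]
    [BorelSpace K] (f : ∀ k, Fin (d k) → K) : Measurable (ulimMap ω f) := by
  refine measurable_of_isClosed fun C hC => ?_
  obtain ⟨O, F, hO, hF, hCO, hOF, hFC⟩ := exists_seq_closed_nhds hC
  rw [ulimMap_preimage_eq_iInter f hO hF hCO hOF hFC]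
  exact MeasurableSet.iInter fun n => measurableSet_internalSet _

/-- With its converse `ae_ulimMap_mem`, this is the dictionary between almost sure statements on
`Z_ω` and asymptotic proportions of coordinates. It is applied to the diagonal of `X × X` and to
points of `Prob(X)`. -/
theorem tendsto_unif_of_ae_ulimMap_mem (hω : IsFree ω) (hd : ∀ k, 0 < d k)
    {f : ∀ k, Fin (d k) → K} {C O : Set K} (h : ∀ᵐ z ∂(loebMeasure d ω), ulimMap ω f z ∈ C)
    (hO : IsOpen O) (hCO : C ⊆ O) :
    Tendsto (fun k => unif (d k) {j | f k j ∈ O}) ω (𝓝 1) := by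
  have := isProbabilityMeasure_loebMeasure hω hd
  have h1 : loebMeasure d ω (internalSet ω fun k => f k ⁻¹' O) = 1 := by
    rw [← mem_ae_iff_prob_eq_one (measurableSet_internalSet _)]
    exact mem_of_superset h fun z hz => ulimMap_preimage_subset_internalSet f hO (hCO hz)
  have h2 := tendsto_unif_internalSet hω hd fun k => f k ⁻¹' O
  rwa [h1] at h2

theorem ae_ulimMap_mem [TopologicalSpace.MetrizableSpace K] (hω : IsFree ω) (hd : ∀ k, 0 < d k)
    {f : ∀ k, Fin (d k) → K} {C : Set K} (hC : IsClosed C)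
    (h : ∀ O, IsOpen O → C ⊆ O → Tendsto (fun k => unif (d k) {j | f k j ∈ O}) ω (𝓝 1)) :
    ∀ᵐ z ∂(loebMeasure d ω), ulimMap ω f z ∈ C := by
  have := isProbabilityMeasure_loebMeasure hω hd
  obtain ⟨O, F, hO, hF, hCO, hOF, hFC⟩ := exists_seq_closed_nhds hC
  have h1 : ulimMap ω f ⁻¹' C ∈ ae (loebMeasure d ω) := by
    rw [ulimMap_preimage_eq_iInter f hO hF hCO hOF hFC, countable_iInter_mem]
    intro n
    rw [mem_ae_iff_prob_eq_one (measurableSet_internalSet _)]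
    exact tendsto_nhds_unique (tendsto_unif_internalSet hω hd _) (h (O n) (hO n) (hCO n))
  exact h1

end UlimMap

/-- Simple functions on the Loeb space lift to sequences of functions. -/
theorem exists_lift_simpleFunc {X : Type*} [Nonempty X] (hω : IsFree ω) (hd : ∀ k, 0 < d k)
    (s : SimpleFunc (LoebSpace d ω) X) :
    ∃ φ : ∀ k, Fin (d k) → X, ∀ᵐ z ∂(loebMeasure d ω), ∀ j : ∀ k, Fin (d k),
      LoebSpace.mk ω j = z → ∀ᶠ k in (ω : Filter ℕ), φ k (j k) = s z := by
  classical
  choose B hB using fun v : X => exists_internalSet_ae_eq hω hd (s.measurableSet_fiber v)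
  refine ⟨fun k i => if h : ∃ v ∈ s.range, i ∈ B v k then h.choose else Classical.arbitrary X, ?_⟩
  have hall : ∀ᵐ z ∂(loebMeasure d ω), ∀ v ∈ s.range, (s z = v ↔ z ∈ internalSet ω (B v)) := by
    refine (Finset.eventually_all _).2 fun v _ => ?_
    filter_upwards [hB v] with z hz
    exact iff_of_eq hz
  filter_upwards [hall] with z hz j hj
  subst hj
  -- As the range is finite, all fibres are decided at once for most `k`. Then `j k` lies in exactly
  -- one `B v k`, and the choice in the definition of the lift is forced.
  have h1 : ∀ᶠ k in (ω : Filter ℕ), ∀ v ∈ s.range, (j k ∈ B v k ↔ s (LoebSpace.mk ω j) = v) := by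
    refine (Finset.eventually_all _).2 fun v hv => ?_
    by_cases hsv : s (LoebSpace.mk ω j) = v
    · filter_upwards [mk_mem_internalSet.1 ((hz v hv).1 hsv)] with k hk
      exact iff_of_true hk hsv
    · have h2 : ¬ LoebSpace.mk ω j ∈ internalSet ω (B v) := fun h => hsv ((hz v hv).2 h)
      rw [mk_mem_internalSet, ← Ultrafilter.eventually_not] at h2
      filter_upwards [h2] with k hk
      exact iff_of_false hk hsv
  filter_upwards [h1] with k hk
  have hex : ∃ v ∈ s.range, j k ∈ B v k :=
    ⟨_, s.mem_range_self _, (hk _ (s.mem_range_self _)).2 rfl⟩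
  rw [dif_pos hex]
  exact ((hk _ hex.choose_spec.1).1 hex.choose_spec.2).symm

theorem exists_simpleFunc_dist_le {X : Type*} [PseudoMetricSpace X] [CompactSpace X] [Nonempty X]
    [MeasurableSpace X] [OpensMeasurableSpace X] {ε : ℝ} (hε : 0 < ε) :
    ∃ s : SimpleFunc X X, ∀ x, dist (s x) x ≤ ε := by
  have hcov : (univ : Set X) ⊆ ⋃ i, Metric.ball (TopologicalSpace.denseSeq X i) ε := by
    intro x _
    obtain ⟨y, hy, ⟨i, rfl⟩⟩ := Metric.dense_iff.1 (TopologicalSpace.denseRange_denseSeq X) x ε hε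
    exact mem_iUnion.2 ⟨i, by rw [Metric.mem_ball, dist_comm]; exact hy⟩
  obtain ⟨t, ht⟩ := isCompact_univ.elim_finite_subcover _ (fun i => Metric.isOpen_ball) hcov
  refine ⟨SimpleFunc.nearestPt (TopologicalSpace.denseSeq X) (t.sup id), fun x => ?_⟩
  obtain ⟨i, hi, hx⟩ := mem_iUnion₂.1 (ht (mem_univ x))
  have h1 := SimpleFunc.edist_nearestPt_le (TopologicalSpace.denseSeq X) x
    (Finset.le_sup (f := id) hi)
  rw [edist_dist, edist_dist, ENNReal.ofReal_le_ofReal_iff dist_nonneg] at h1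
  rw [Metric.mem_ball, dist_comm] at hx
  exact h1.trans hx.le

/-- Measurable maps from the Loeb space to a compact metrizable space lift to sequences of
functions. -/
theorem exists_lift {X : Type*} [TopologicalSpace X] [CompactSpace X]
    [TopologicalSpace.MetrizableSpace X] [MeasurableSpace X] [BorelSpace X]
    (hω : IsFree ω) (hd : ∀ k, 0 < d k) {Φ : LoebSpace d ω → X} (hΦ : Measurable Φ) :
    ∃ φ : ∀ k, Fin (d k) → X, ulimMap ω φ =ᵐ[loebMeasure d ω] Φ := by
  let _ := TopologicalSpace.metrizableSpaceMetric X
  have := isProbabilityMeasure_loebMeasure hω hd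
  have : Nonempty X := ⟨Φ (LoebSpace.mk ω fun k => ⟨0, hd k⟩)⟩
  let δ : ℕ → ℝ := fun n => 1 / ((n : ℝ) + 1)
  have hδ : ∀ n, 0 < δ n := fun n => by positivity
  have hδ0 : Tendsto δ atTop (𝓝 0) := tendsto_one_div_add_atTop_nhds_zero_nat
  choose s hs using fun n => exists_simpleFunc_dist_le (X := X) (hδ n)
  choose φ hφ using fun n => exists_lift_simpleFunc hω hd ((s n).comp Φ hΦ)
  -- The lifts at levels `n` and `m` approximate the same map within `δ n` and `δ m`, so they can be
  -- further apart only on a small proportion of coordinates. The diagonal lift inherits this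
  -- comparison with every fixed level `n`.
  have hP : ∀ m, ∀ᶠ k in (ω : Filter ℕ), ∀ n ∈ Finset.range (m + 1),
      unif (d k) {j | δ n + δ m < dist (φ n k j) (φ m k j)} < ((m : ENNReal) + 1)⁻¹ := by
    intro m
    refine (Finset.eventually_all _).2 fun n _ => ?_
    have h0 : loebMeasure d ω
        (internalSet ω fun k => {j | δ n + δ m < dist (φ n k j) (φ m k j)}) = 0 := by
      rw [measure_eq_zero_iff_ae_notMem]
      filter_upwards [hφ n, hφ m] with z hn hm hz
      obtain ⟨j, rfl⟩ := z.exists_mk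
      rw [mk_mem_internalSet] at hz
      obtain ⟨k, hk, hkn, hkm⟩ := (hz.and ((hn j rfl).and (hm j rfl))).exists
      rw [mem_ofPred_eq, hkn, hkm] at hk
      exact absurd ((dist_triangle_right _ _ _).trans
        (add_le_add (hs n (Φ (LoebSpace.mk ω j))) (hs m (Φ (LoebSpace.mk ω j))))) (not_le.2 hk)
    have h1 := tendsto_unif_internalSet hω hd
      (fun k => {j | δ n + δ m < dist (φ n k j) (φ m k j)}) (ω := ω)
    rw [h0] at h1
    exact h1.eventually_lt_const (by simp)
  obtain ⟨N, hN, hNP⟩ := hω.exists_diagonal hP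
  refine ⟨fun k => φ (N k) k, ?_⟩
  have hnull : ∀ n, ∀ᵐ z ∂(loebMeasure d ω),
      z ∉ internalSet ω fun k => {j | δ n + δ (N k) < dist (φ n k j) (φ (N k) k j)} := by
    intro n
    rw [← measure_eq_zero_iff_ae_notMem]
    refine le_antisymm (le_of_tendsto_of_tendsto (tendsto_unif_internalSet hω hd _)
      (tendsto_inv_nat_add_one.comp hN) ?_) bot_le
    filter_upwards [hNP, hN.eventually_ge_atTop n] with k h1 h2
    exact (h1 n (Finset.mem_range.2 (by omega))).le
  filter_upwards [ae_all_iff.2 hnull, ae_all_iff.2 hφ] with z hz1 hz2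
  obtain ⟨j, rfl⟩ := z.exists_mk
  set z := LoebSpace.mk ω j with hz
  -- One `δ n` comes from comparing the diagonal lift with level `n` (the term `δ (N k)` vanishes in
  -- the limit), the other from the simple function at level `n`.
  have hle : ∀ n, dist (ulimMap ω (fun k => φ (N k) k) z) (Φ z) ≤ δ n + δ n := by
    intro n
    have h1 := hz1 n
    rw [hz, mk_mem_internalSet, ← Ultrafilter.eventually_not] at h1
    have h2 : Tendsto (fun k => dist (s n (Φ z)) (φ (N k) k (j k))) ω
        (𝓝 (dist (s n (Φ z)) (ulimMap ω (fun k => φ (N k) k) z))) :=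
      tendsto_const_nhds.dist (tendsto_ulimMap (fun k => φ (N k) k) j)
    have h3 : Tendsto (fun k => δ n + δ (N k)) ω (𝓝 (δ n + 0)) :=
      tendsto_const_nhds.add (hδ0.comp hN)
    rw [add_zero] at h3
    have h4 : dist (s n (Φ z)) (ulimMap ω (fun k => φ (N k) k) z) ≤ δ n := by
      refine le_of_tendsto_of_tendsto h2 h3 ?_
      filter_upwards [h1, hz2 n j rfl] with k hk1 hk2
      rw [not_lt, hk2] at hk1
      exact hk1
    rw [dist_comm] at h4
    exact (dist_triangle _ _ _).trans (add_le_add h4 (hs n _))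
  have hlim := hδ0.add hδ0
  rw [add_zero] at hlim
  exact dist_le_zero.1 (ge_of_tendsto' hlim hle)

end

/-! ### Least-norm points and constant vectors in Hilbert spaces of maps. -/

section

open scoped RealInnerProductSpace

/-- The point of least norm in a closed convex hull is fixed by all linear isometries that preserve
the generating set. -/
theorem exists_mem_closure_convexHull_fixed {H : Type*} [NormedAddCommGroup H]
    [InnerProductSpace ℝ H] [CompleteSpace H] {V : Set H} (hV : V.Nonempty) :
    ∃ c ∈ closure (convexHull ℝ V), ∀ T : H →ₗᵢ[ℝ] H, MapsTo T V V → T c = c := by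
  have hconv : Convex ℝ (closure (convexHull ℝ V)) := (convex_convexHull ℝ V).closure
  obtain ⟨c, hc, hmin⟩ := exists_norm_eq_iInf_of_complete_convex
    (hV.mono ((subset_convexHull ℝ V).trans subset_closure)) isClosed_closure.isComplete hconv 0
  rw [norm_eq_iInf_iff_real_inner_le_zero hconv hc] at hmin
  refine ⟨c, hc, fun T hT => ?_⟩
  have hT1 : MapsTo T (convexHull ℝ V) (convexHull ℝ V) := by
    rw [mapsTo_iff_image_subset]
    have h1 := T.toLinearMap.image_convexHull V
    have h2 : T '' convexHull ℝ V = convexHull ℝ (T '' V) := h1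
    rw [h2]
    exact convexHull_mono hT.image_subset
  have hTc : T c ∈ closure (convexHull ℝ V) := hT1.closure T.continuous hc
  -- Minimality tested against `T c` gives `‖c‖² ≤ ⟪c, T c⟫`; together with `‖T c‖ = ‖c‖` this is
  -- equality in Cauchy–Schwarz.
  have h1 := hmin _ hTc
  rw [zero_sub, inner_neg_left, inner_sub_right, real_inner_self_eq_norm_sq] at h1
  have h2 := norm_sub_sq_real (T c) c
  rw [T.norm_map, real_inner_comm] at h2
  have h3 : ‖T c - c‖ ^ 2 ≤ 0 := by linarith
  rw [← sub_eq_zero, ← norm_le_zero_iff]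
  nlinarith [norm_nonneg (T c - c)]

section Abstract

variable {Z : Type*} [MeasurableSpace Z] {u : Measure Z}
  {A : Type*} [Monoid A] [TopologicalSpace A]
  {𝓗 : Type*} [NormedAddCommGroup 𝓗] [InnerProductSpace ℝ 𝓗]
  [DistribMulAction A 𝓗] [SMulCommClass ℝ A 𝓗] [ContinuousSMul A 𝓗] [IsIsometricSMul A 𝓗]

omit [TopologicalSpace A] [ContinuousSMul A 𝓗] [InnerProductSpace ℝ 𝓗] [SMulCommClass ℝ A 𝓗] in
theorem norm_smul_of_isIsometricSMul (a : A) (x : 𝓗) : ‖a • x‖ = ‖x‖ := by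
  have h := dist_smul a x 0
  rwa [smul_zero, dist_zero_right, dist_zero_right] at h

variable (𝓗) in
/-- The isometry by which an element of an isometrically acting monoid acts. -/
def smulLinearIsometry (a : A) : 𝓗 →ₗᵢ[ℝ] 𝓗 where
  toFun x := a • x
  map_add' x y := smul_add a x y
  map_smul' r x := (smul_comm r a x).symm
  norm_map' x := norm_smul_of_isIsometricSMul a x

omit [InnerProductSpace ℝ 𝓗] [SMulCommClass ℝ A 𝓗] in
theorem memLp_smul {a : Z → A} (ha : AEStronglyMeasurable a u) {v : Z → 𝓗} (hv : MemLp v 2 u) :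
    MemLp (fun z => a z • v z) 2 u :=
  hv.congr_norm (ha.smul hv.1) (ae_of_all _ fun _ => (norm_smul_of_isIsometricSMul _ _).symm)

/-- Pointwise action of a measurable map on square integrable maps. -/
noncomputable def smulIsometry {a : Z → A} (ha : AEStronglyMeasurable a u) :
    Lp 𝓗 2 u →ₗᵢ[ℝ] Lp 𝓗 2 u where
  toFun v := (memLp_smul ha (Lp.memLp v)).toLp _
  map_add' v w := by
    rw [← MemLp.toLp_add, MemLp.toLp_eq_toLp_iff]
    filter_upwards [Lp.coeFn_add v w] with z hz
    simp only [hz, Pi.add_apply, smul_add]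
  map_smul' r v := by
    rw [RingHom.id_apply, ← MemLp.toLp_const_smul, MemLp.toLp_eq_toLp_iff]
    filter_upwards [Lp.coeFn_smul r v] with z hz
    simp only [hz, Pi.smul_apply, smul_comm r (a z)]
  norm_map' v := by
    change ‖(memLp_smul ha (Lp.memLp v)).toLp _‖ = ‖v‖
    rw [Lp.norm_toLp _ (memLp_smul ha (Lp.memLp v)), Lp.norm_def]
    exact congrArg _ (eLpNorm_congr_norm_ae
      (ae_of_all _ fun z => norm_smul_of_isIsometricSMul _ _))

theorem coeFn_smulIsometry {a : Z → A} (ha : AEStronglyMeasurable a u) (v : Lp 𝓗 2 u) :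
    smulIsometry ha v =ᵐ[u] fun z => a z • v z :=
  MemLp.coeFn_toLp (memLp_smul ha (Lp.memLp v))

/-- A measurable map that is invariant under an ergodic family of transformations is constant. -/
theorem exists_ae_eq_const_of_ergodic {Γ : Set (Z → Z)} {Y : Type*}
    [TopologicalSpace Y] [TopologicalSpace.MetrizableSpace Y] [SecondCountableTopology Y]
    [Nonempty Y]
    (herg : ∀ S, MeasurableSet S → (∀ p ∈ Γ, p ⁻¹' S =ᵐ[u] S) → u S = 0 ∨ u Sᶜ = 0)
    {v : Z → Y} (hv : StronglyMeasurable v) (hinv : ∀ p ∈ Γ, v ∘ p =ᵐ[u] v) :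
    ∃ w, v =ᵐ[u] fun _ => w := by
  borelize Y
  refine exists_eventuallyEq_const_of_forall_separating MeasurableSet fun S hS => ?_
  have h1 : ∀ p ∈ Γ, p ⁻¹' (v ⁻¹' S) =ᵐ[u] v ⁻¹' S := fun p hp => by
    filter_upwards [hinv p hp] with z hz
    exact congrArg (· ∈ S) hz
  rcases herg (v ⁻¹' S) (hv.measurable hS) h1 with h | h
  · exact Or.inr (measure_eq_zero_iff_ae_notMem.1 h)
  · refine Or.inl ?_
    filter_upwards [measure_eq_zero_iff_ae_notMem.1 h] with z hz
    simpa using hz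

/-- Let `M` be a set of maps from a measure space to a monoid acting isometrically on a Hilbert
space, closed under multiplication and under an ergodic family of transformations. The closed
convex hull of the orbit maps of a vector `ξ` under `M` contains a constant map, whose value is
fixed by the maps in `M`. -/
theorem exists_const_mem_closure_convexHull [IsProbabilityMeasure u] [CompleteSpace 𝓗]
    [SecondCountableTopology 𝓗] {M : Set (Z → A)} (hM : M.Nonempty)
    (hmeas : ∀ a ∈ M, AEStronglyMeasurable a u) (hmul : ∀ a ∈ M, ∀ b ∈ M, a * b ∈ M)
    {Γ : Set (Z → Z)} (hΓ : ∀ p ∈ Γ, MeasurePreserving p u u)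
    (hcomp : ∀ a ∈ M, ∀ p ∈ Γ, a ∘ p ∈ M)
    (herg : ∀ S, MeasurableSet S → (∀ p ∈ Γ, p ⁻¹' S =ᵐ[u] S) → u S = 0 ∨ u Sᶜ = 0) (ξ : 𝓗) :
    ∃ w : 𝓗, (∀ a ∈ M, ∀ᵐ z ∂u, a z • w = w) ∧
      Lp.const 2 u w ∈
        closure (convexHull ℝ {v : Lp 𝓗 2 u | ∃ a ∈ M, v =ᵐ[u] fun z => a z • ξ}) := by
  have hV : {v : Lp 𝓗 2 u | ∃ a ∈ M, v =ᵐ[u] fun z => a z • ξ}.Nonempty := by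
    obtain ⟨a, ha⟩ := hM
    exact ⟨(memLp_smul (hmeas a ha) (memLp_const ξ)).toLp _, a, ha, MemLp.coeFn_toLp _⟩
  obtain ⟨c, hc, hfix⟩ := exists_mem_closure_convexHull_fixed hV
  have hΓc : ∀ p ∈ Γ, c ∘ p =ᵐ[u] c := by
    intro p hp
    -- Composition with `p` permits ergodicity to be applied: `c` is invariant under `Γ`, hence
    -- constant.
    have h1 := hfix (Lp.compMeasurePreservingₗᵢ ℝ p (hΓ p hp)) (by
      rintro v ⟨a, ha, hv⟩
      refine ⟨a ∘ p, hcomp a ha p hp, (Lp.coeFn_compMeasurePreserving v (hΓ p hp)).trans ?_⟩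
      exact (hΓ p hp).quasiMeasurePreserving.ae_eq_comp hv)
    have h2 := Lp.coeFn_compMeasurePreserving c (hΓ p hp)
    have h3 : Lp.compMeasurePreserving p (hΓ p hp) c = c := h1
    rw [h3] at h2
    exact h2.symm
  obtain ⟨w, hw⟩ := exists_ae_eq_const_of_ergodic herg (Lp.stronglyMeasurable c) hΓc
  have hcw : c = Lp.const 2 u w := Lp.ext (hw.trans (Lp.coeFn_const 2 u w).symm)
  refine ⟨w, fun a ha => ?_, hcw ▸ hc⟩
  -- Pointwise action by `a` also preserves the orbit maps, since `M` is closed under products;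
  -- hence the constant value is fixed by `a z` for almost every `z`.
  have h1 := hfix (smulIsometry (hmeas a ha)) (by
    rintro v ⟨b, hb, hv⟩
    refine ⟨a * b, hmul a ha b hb, (coeFn_smulIsometry _ v).trans ?_⟩
    filter_upwards [hv] with z hz
    rw [hz, Pi.mul_apply, mul_smul])
  have h2 := coeFn_smulIsometry (hmeas a ha) c
  rw [h1] at h2
  filter_upwards [h2, hw] with z hz hz'
  rw [hz'] at hz
  exact hz.symm

end Abstract

end

section

open scoped RealInnerProductSpace

/-! ### Haar measures of closed subgroups -/

section Haar

variable {K : Type*} [Group K] [TopologicalSpace K] [IsTopologicalGroup K] [CompactSpace K]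
  [MeasurableSpace K] [BorelSpace K]

instance : (haarProb K : Measure K).IsHaarMeasure :=
  inferInstanceAs (Measure.haarMeasure (⊤ : TopologicalSpace.PositiveCompacts K)).IsHaarMeasure

/-- Compact groups are unimodular: a right translate of the Haar measure is again a left-invariant
probability measure, so uniqueness applies. -/
theorem map_mul_right_haarProb (a : K) :
    (haarProb K : Measure K).map (· * a) = haarProb K := by
  have := Measure.isProbabilityMeasure_map (μ := (haarProb K : Measure K))
    (measurable_mul_const a).aemeasurable
  exact Measure.isHaarMeasure_eq_of_isProbabilityMeasure _ _

variable {X : Type*} [Group X] [TopologicalSpace X] [IsTopologicalGroup X] [CompactSpace X]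
  [MeasurableSpace X] [BorelSpace X]

theorem coe_haarSub (H : ClosedSubgroup X) :
    haveI : IsTopologicalGroup H := inferInstanceAs (IsTopologicalGroup H.toSubgroup)
    (haarSub H : Measure X) = (haarProb H : Measure H).map (fun x : H => (x : X)) := rfl

theorem map_mul_right_haarSub (H : ClosedSubgroup X) {a : X} (ha : a ∈ H) :
    (haarSub H : Measure X).map (· * a) = haarSub H := by
  have : IsTopologicalGroup H := inferInstanceAs (IsTopologicalGroup H.toSubgroup)
  rw [coe_haarSub, Measure.map_map (measurable_mul_const a) measurable_subtype_coe]
  conv_rhs => rw [← map_mul_right_haarProb (⟨a, ha⟩ : H),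
    Measure.map_map measurable_subtype_coe (measurable_mul_const _)]
  rfl

theorem integral_haarSub_mul_right {B : Type*} [NormedAddCommGroup B] [NormedSpace ℝ B]
    (H : ClosedSubgroup X) {a : X} (ha : a ∈ H) (F : X → B) :
    ∫ y, F (y * a) ∂(haarSub H : Measure X) = ∫ y, F y ∂(haarSub H : Measure X) := by
  have h : MeasurePreserving (· * a) (haarSub H : Measure X) (haarSub H) :=
    ⟨measurable_mul_const a, map_mul_right_haarSub H ha⟩
  exact h.integral_comp' (f := (Homeomorph.mulRight a).toMeasurableEquiv) F

theorem ae_haarSub_mem (H : ClosedSubgroup X) : ∀ᵐ x ∂(haarSub H : Measure X), x ∈ H := by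
  have : IsTopologicalGroup H := inferInstanceAs (IsTopologicalGroup H.toSubgroup)
  rw [coe_haarSub]
  refine (ae_map_iff measurable_subtype_coe.aemeasurable H.isClosed'.measurableSet).2 ?_
  exact ae_of_all _ fun x => x.2

/-- The support of the Haar measure of a closed subgroup is the subgroup. -/
theorem subset_of_ae_haarSub_mem (H : ClosedSubgroup X) {C : Set X} (hC : IsClosed C)
    (h : ∀ᵐ x ∂(haarSub H : Measure X), x ∈ C) : (H : Set X) ⊆ C := by
  have : IsTopologicalGroup H := inferInstanceAs (IsTopologicalGroup H.toSubgroup)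
  replace h := (ae_map_iff measurable_subtype_coe.aemeasurable hC.measurableSet).1 h
  have h1 : IsClosed {x : H | (x : X) ∈ C} := hC.preimage continuous_subtype_val
  have h2 : {x : H | (x : X) ∈ C}ᶜ = ∅ := by
    rw [← h1.isOpen_compl.measure_eq_zero_iff (haarProb H : Measure H)]
    exact h
  intro x hx
  by_contra hcon
  have h3 : (⟨x, hx⟩ : H) ∈ {x : H | (x : X) ∈ C}ᶜ := hcon
  rw [h2] at h3
  exact h3

theorem haarSub_eq_haarProb {H : ClosedSubgroup X} (h : (H : Set X) = univ) :
    haarSub H = haarProb X := by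
  refine Subtype.ext ?_
  have : IsTopologicalGroup H := inferInstanceAs (IsTopologicalGroup H.toSubgroup)
  have h1 : ((haarProb H : Measure H).map (fun x : H => (x : X))).IsHaarMeasure :=
    Measure.isHaarMeasure_map_of_isFiniteMeasure _ (H.toSubgroup.subtype)
      continuous_subtype_val (fun x => ⟨⟨x, h.ge (mem_univ x)⟩, rfl⟩)
  have h2 : (haarSub H : Measure X).IsHaarMeasure := h1
  exact Measure.isHaarMeasure_eq_of_isProbabilityMeasure (haarSub H : Measure X) (haarProb X)

end Haar

/-! ### Ergodic averages of maps to a compact group -/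

section Averages

variable {X : Type*} [Group X] [TopologicalSpace X] [IsTopologicalGroup X] [CompactSpace X]
  [TopologicalSpace.MetrizableSpace X] [MeasurableSpace X] [BorelSpace X]
  {E : Type*} [NormedAddCommGroup E] [InnerProductSpace ℝ E] [CompleteSpace E]
  [SecondCountableTopology E]

open DomMulAct

omit [SecondCountableTopology E] in
/-- Evaluation at `1` of continuous functions on a compact group is approximated, uniformly on
translates, by bounded operators on the space of square integrable functions. -/
theorem exists_clm_approx_eval {f : X → E} (hf : Continuous f)
    (hfL : MemLp f 2 (haarProb X : Measure X)) {ε : ℝ} (hε : 0 < ε) :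
    ∃ J : Lp E 2 (haarProb X : Measure X) →L[ℝ] E, ∀ y : X, ‖J (mk y • hfL.toLp f) - f y‖ ≤ ε := by
  -- Point evaluation is not defined on `L²`, so it is replaced by the mean over a small
  -- neighbourhood `U` of `1`. Compactness of `X` makes `U` uniform in the translation `y`.
  set m := (haarProb X : Measure X) with hm
  obtain ⟨U, hU, h1U, hUf⟩ : ∃ U : Set X, IsOpen U ∧ (1 : X) ∈ U ∧
      ∀ x ∈ U, ∀ y, ‖f (y * x) - f y‖ ≤ ε := by
    have hc : Continuous fun p : X × X => ‖f (p.2 * p.1) - f p.2‖ := by fun_prop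
    have hopen : IsOpen {p : X × X | ‖f (p.2 * p.1) - f p.2‖ < ε} := isOpen_lt hc continuous_const
    have hsub : ({1} : Set X) ×ˢ (univ : Set X) ⊆ {p : X × X | ‖f (p.2 * p.1) - f p.2‖ < ε} := by
      rintro ⟨x, y⟩ ⟨hx, -⟩
      obtain rfl : x = 1 := hx
      simpa using hε
    obtain ⟨U, V, hU, hV, h1, h2, h3⟩ :=
      generalized_tube_lemma isCompact_singleton isCompact_univ hopen hsub
    exact ⟨U, hU, h1 rfl, fun x hx y => le_of_lt (show ‖f (y * x) - f y‖ < ε from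
      h3 (mk_mem_prod hx (h2 (mem_univ y))))⟩
  have hmU : 0 < m.real U :=
    ENNReal.toReal_pos (hU.measure_pos m ⟨1, h1U⟩).ne' (measure_ne_top _ _)
  have hint : ∀ v : Lp E 2 m, Integrable v m := fun v => (Lp.memLp v).integrable (by norm_num)
  let J₀ : Lp E 2 m →ₗ[ℝ] E :=
    { toFun := fun v => (m.real U)⁻¹ • ∫ x in U, v x ∂m
      map_add' := fun v w => by
        rw [← smul_add, ← integral_add (hint v).integrableOn (hint w).integrableOn]
        congr 1
        exact integral_congr_ae (ae_restrict_of_ae (Lp.coeFn_add v w))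
      map_smul' := fun r v => by
        rw [RingHom.id_apply, smul_comm, ← integral_smul r]
        congr 1
        exact integral_congr_ae (ae_restrict_of_ae (Lp.coeFn_smul r v)) }
  have hJ₀ : ∀ v, ‖J₀ v‖ ≤ (m.real U)⁻¹ * ‖v‖ := by
    intro v
    change ‖(m.real U)⁻¹ • ∫ x in U, v x ∂m‖ ≤ _
    rw [norm_smul, Real.norm_of_nonneg (inv_nonneg.2 hmU.le)]
    gcongr
    calc ‖∫ x in U, v x ∂m‖ ≤ ∫ x in U, ‖v x‖ ∂m := norm_integral_le_integral_norm _
      _ ≤ ∫ x, ‖v x‖ ∂m :=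
        setIntegral_le_integral (hint v).norm (ae_of_all _ fun _ => norm_nonneg _)
      _ = (eLpNorm v 1 m).toReal := by
        rw [eLpNorm_one_eq_lintegral_enorm, integral_norm_eq_lintegral_enorm (hint v).1]
      _ ≤ (eLpNorm v 2 m).toReal := ENNReal.toReal_mono (Lp.eLpNorm_ne_top v)
        (eLpNorm_le_eLpNorm_of_exponent_le (by norm_num) (Lp.aestronglyMeasurable v))
      _ = ‖v‖ := (Lp.norm_def v).symm
  refine ⟨J₀.mkContinuous _ hJ₀, fun y => ?_⟩
  have h1 : J₀ (mk y • hfL.toLp f) = (m.real U)⁻¹ • ∫ x in U, f (y * x) ∂m := by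
    change (m.real U)⁻¹ • ∫ x in U, (mk y • hfL.toLp f) x ∂m = _
    congr 1
    refine integral_congr_ae (ae_restrict_of_ae ?_)
    rw [mk_smul_toLp]
    exact MemLp.coeFn_toLp _
  rw [LinearMap.mkContinuous_apply, h1]
  have hci : IntegrableOn (fun x => f (y * x)) U m :=
    ((hf.comp (continuous_const_mul y)).continuousOn.integrableOn_compact
      isCompact_univ).mono_set (subset_univ U)
  have h2 : (m.real U)⁻¹ • ∫ x in U, f (y * x) ∂m - f y =
      (m.real U)⁻¹ • ∫ x in U, (f (y * x) - f y) ∂m := by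
    rw [integral_sub hci (integrable_const _), setIntegral_const, smul_sub, smul_smul,
      inv_mul_cancel₀ hmU.ne', one_smul]
  rw [h2, norm_smul, Real.norm_of_nonneg (inv_nonneg.2 hmU.le), inv_mul_le_iff₀ hmU, mul_comm]
  exact norm_setIntegral_le_of_norm_le_const (measure_lt_top _ _) fun x hx => hUf x hx y

/-- Let `M` be a set of maps to a compact group which is closed under multiplication and under an
ergodic family of transformations, and let `Y` be the smallest closed subgroup in which these maps
take their values. Then pointwise convex combinations of point masses at elements of `M`
approximate the Haar measure of `Y`. -/
theorem exists_convexCombination_close_haarSub {Z : Type*} [MeasurableSpace Z] {u : Measure Z}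
    [IsProbabilityMeasure u] {M : Set (Z → X)} (hM : M.Nonempty)
    (hmeas : ∀ Φ ∈ M, Measurable Φ) (hmul : ∀ Φ ∈ M, ∀ Ψ ∈ M, Φ * Ψ ∈ M)
    {Γ : Set (Z → Z)} (hΓ : ∀ p ∈ Γ, MeasurePreserving p u u)
    (hcomp : ∀ Φ ∈ M, ∀ p ∈ Γ, Φ ∘ p ∈ M)
    (herg : ∀ S, MeasurableSet S → (∀ p ∈ Γ, p ⁻¹' S =ᵐ[u] S) → u S = 0 ∨ u Sᶜ = 0)
    {Y : ClosedSubgroup X} (hYM : ∀ Φ ∈ M, ∀ᵐ z ∂u, Φ z ∈ Y)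
    (hYmin : ∀ H : ClosedSubgroup X, (∀ Φ ∈ M, ∀ᵐ z ∂u, Φ z ∈ H) → Y ≤ H)
    {f : X → E} (hf : Continuous f) {ε : ℝ} (hε : 0 < ε) :
    ∃ (n : ℕ) (c : Fin n → ℝ) (Φ : Fin n → Z → X), (∀ i, 0 ≤ c i) ∧ ∑ i, c i = 1 ∧
      (∀ i, Φ i ∈ M) ∧
      u {z | ε ≤ ‖∑ i, c i • f (Φ i z) - ∫ y, f y ∂(haarSub Y : Measure X)‖} ≤
        ENNReal.ofReal ε := by
  have h2top : Fact ((2 : ENNReal) ≠ ⊤) := ⟨ENNReal.ofNat_ne_top⟩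
  set m := (haarProb X : Measure X) with hm
  set mY := (haarSub Y : Measure X) with hmY
  have hfL : MemLp f 2 m := by
    obtain ⟨C, hC⟩ := isCompact_univ.exists_bound_of_continuousOn hf.continuousOn
    exact MemLp.of_bound hf.aestronglyMeasurable C (ae_of_all _ fun x => hC x (mem_univ x))
  set ξ : Lp E 2 m := hfL.toLp f with hξ
  have horb : Continuous fun y : X => (mk y • ξ : Lp E 2 m) :=
    continuous_mk.smul continuous_const
  have horbi : Integrable (fun y : X => (mk y • ξ : Lp E 2 m)) mY :=
    integrableOn_univ.1 (horb.continuousOn.integrableOn_compact isCompact_univ)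
  -- The action is `(mk y • f) x = f (y * x)`, whose value at `x = 1` is `f y`. It is an action of
  -- the opposite group, so products appear reversed below and right invariance of the Haar measure
  -- is the relevant one.
  let A : Set (Z → Xᵈᵐᵃ) := (fun Φ z => mk (Φ z)) '' M
  have hAmeas : ∀ a ∈ A, AEStronglyMeasurable a u := by
    rintro _ ⟨Φ, hΦ, rfl⟩
    exact continuous_mk.comp_aestronglyMeasurable (hmeas Φ hΦ).stronglyMeasurable.aestronglyMeasurable
  obtain ⟨w, hwfix, hwmem⟩ := exists_const_mem_closure_convexHull (hM.image _) hAmeas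
    (by
      rintro _ ⟨Φ, hΦ, rfl⟩ _ ⟨Ψ, hΨ, rfl⟩
      exact ⟨Ψ * Φ, hmul Ψ hΨ Φ hΦ, rfl⟩) hΓ
    (by
      rintro _ ⟨Φ, hΦ, rfl⟩ p hp
      exact ⟨Φ ∘ p, hcomp Φ hΦ p hp, rfl⟩) herg ξ
  have hwY : ∀ y ∈ Y, mk y • w = w := by
    -- The stabilizer of `w` is a closed subgroup containing almost all values of every element of
    -- `M`, so minimality of `Y` applies.
    let S : ClosedSubgroup X :=
      { carrier := {y | mk y • w = w}
        mul_mem' := fun {a b} ha hb => by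
          simp only [mem_ofPred_eq] at ha hb ⊢
          rw [mk_mul, mul_smul, ha, hb]
        one_mem' := by
          simp only [mem_ofPred_eq, mk_one, one_smul]
        inv_mem' := fun {a} ha => by
          simp only [mem_ofPred_eq] at ha ⊢
          rw [mk_inv, inv_smul_eq_iff, ha]
        isClosed' := isClosed_eq (continuous_mk.smul continuous_const) continuous_const }
    exact hYmin S fun Φ hΦ => hwfix _ ⟨Φ, hΦ, rfl⟩
  set τ : Lp E 2 m := ∫ y, mk y • ξ ∂mY with hτ
  have hinner : ∀ ζ : Lp E 2 m, (∀ y ∈ Y, mk y • ζ = ζ) → ∀ y ∈ Y, ⟪ζ, mk y • ξ⟫ = ⟪ζ, ξ⟫ := by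
    intro ζ hζ y hy
    have h1 := (smulLinearIsometry (Lp E 2 m) (mk y)).inner_map_map ζ ξ
    have h2 : ⟪mk y • ζ, mk y • ξ⟫ = ⟪ζ, ξ⟫ := h1
    rwa [hζ y hy] at h2
  have hτY : ∀ y ∈ Y, mk y • τ = τ := by
    intro a ha
    have h1 := (smulLinearIsometry (Lp E 2 m) (mk a)).integral_comp_comm (μ := mY)
      (fun y => mk y • ξ)
    have h2 : ∫ y, mk a • mk y • ξ ∂mY = mk a • τ := h1
    have h3 := integral_haarSub_mul_right Y ha fun y => (mk y • ξ : Lp E 2 m)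
    simp only [mk_mul, mul_smul] at h3
    exact h2.symm.trans h3
  have hτξ : ∀ ζ : Lp E 2 m, (∀ y ∈ Y, mk y • ζ = ζ) → ⟪ζ, τ⟫ = ⟪ζ, ξ⟫ := by
    intro ζ hζ
    rw [hτ, ← integral_inner horbi]
    have h1 : (fun y => ⟪ζ, mk y • ξ⟫) =ᵐ[mY] fun _ => ⟪ζ, ξ⟫ := by
      filter_upwards [ae_haarSub_mem Y] with y hy using hinner ζ hζ y hy
    rw [integral_congr_ae h1, integral_const, probReal_univ, one_smul]
  have hwξ : ∀ ζ : Lp E 2 m, (∀ y ∈ Y, mk y • ζ = ζ) → ⟪ζ, w⟫ = ⟪ζ, ξ⟫ := by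
    intro ζ hζ
    -- Pairing with the constant map at a `Y`-fixed `ζ` takes the same value on all orbit maps,
    -- because these act through elements of `Y`. The affine condition is closed, so it holds on the
    -- whole hull.
    have hsub : closure (convexHull ℝ {v : Lp (Lp E 2 m) 2 u | ∃ a ∈ A, v =ᵐ[u] fun z => a z • ξ}) ⊆
        {v | ⟪Lp.const 2 u ζ, v⟫ = ⟪ζ, ξ⟫} := by
      refine closure_minimal (convexHull_min ?_ ?_)
        (isClosed_eq (continuous_const.inner continuous_id) continuous_const)
      · rintro v ⟨_, ⟨Φ, hΦ, rfl⟩, hv⟩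
        have h1 : (fun z => ⟪Lp.const 2 u ζ z, v z⟫) =ᵐ[u] fun _ => ⟪ζ, ξ⟫ := by
          filter_upwards [hv, Lp.coeFn_const 2 u ζ, hYM Φ hΦ] with z h2 h3 h4
          rw [h2, h3, Function.const_apply, hinner ζ hζ _ h4]
        rw [mem_ofPred_eq, L2.inner_def, integral_congr_ae h1, integral_const, probReal_univ,
          one_smul]
      · exact convex_hyperplane (innerₛₗ ℝ (Lp.const 2 u ζ)).isLinear _
    have h1 := hsub hwmem
    have h2 : (fun z => ⟪Lp.const 2 u ζ z, Lp.const 2 u w z⟫) =ᵐ[u] fun _ => ⟪ζ, w⟫ := by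
      filter_upwards [Lp.coeFn_const 2 u ζ, Lp.coeFn_const 2 u w] with z h3 h4
      rw [h3, h4, Function.const_apply, Function.const_apply]
    rwa [mem_ofPred_eq, L2.inner_def, integral_congr_ae h2, integral_const, probReal_univ,
      one_smul] at h1
  -- Both vectors are `Y`-fixed and pair in the same way with `Y`-fixed vectors, so their difference
  -- is orthogonal to itself.
  have hwτ : w = τ := by
    have hfix : ∀ y ∈ Y, mk y • (w - τ) = w - τ := fun y hy => by
      rw [smul_sub, hwY y hy, hτY y hy]
    rw [← sub_eq_zero, ← inner_self_eq_zero (𝕜 := ℝ)]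
    conv_lhs => rw [inner_sub_right, hτξ _ hfix, hwξ _ hfix, sub_self]
  -- Error budget: replacing evaluation by `J` costs `ε / 4` twice, and `‖J‖ * δ` costs another `ε /
  -- 4`. An error of at least `ε` therefore forces an `L²(X)`-distance of at least `δ`. The `+ 1` in
  -- `δ` covers `J = 0`.
  obtain ⟨J, hJ⟩ := exists_clm_approx_eval hf hfL (by positivity : 0 < ε / 4)
  set δ : ℝ := ε / (4 * (‖J‖ + 1)) with hδdef
  have hJ0 : 0 ≤ ‖J‖ := norm_nonneg J
  have hδ : 0 < δ := by positivity
  have hJδ : ‖J‖ * δ ≤ ε / 4 := by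
    rw [hδdef, mul_div_assoc', div_le_div_iff₀ (by positivity) (by norm_num)]
    nlinarith
  -- With this radius, Chebyshev's inequality at level `δ` bounds the exceptional set by `(min 1 ε)²
  -- ≤ ε`.
  have hη : 0 < δ * min 1 ε := by positivity
  obtain ⟨v, hv, hvdist⟩ := Metric.mem_closure_iff.1 hwmem _ hη
  obtain ⟨ι, _, c, V, hc0, hc1, hV, hsum⟩ := mem_convexHull_iff_exists_fintype.1 hv
  choose a ha hVa using hV
  choose Φ hΦ hΦa using ha
  have hdiff : {z | ε ≤ ‖∑ i, c i • f (Φ i z) - ∫ y, f y ∂mY‖} ≤ᵐ[u]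
      {z | ENNReal.ofReal (δ ^ 2) ≤ ‖(Lp.const 2 u w - v) z‖ₑ ^ (2 : ENNReal).toReal} := by
    have h0 : ∀ᵐ z ∂u, ∀ i, V i z = a i z • ξ := ae_all_iff.2 hVa
    filter_upwards [Lp.coeFn_const 2 u w, Lp.coeFn_sub (Lp.const 2 u w) v, h0,
      Lp.coeFn_finsetSum Finset.univ fun i => c i • V i,
      ae_all_iff.2 fun i => Lp.coeFn_smul (c i) (V i)] with z h1 h2 h3 h4 h5 h6
    change ε ≤ _ at h6
    change ENNReal.ofReal (δ ^ 2) ≤ _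
    have h7 : v z = ∑ i, c i • (mk (Φ i z) • ξ : Lp E 2 m) := by
      rw [← hsum, h4, Finset.sum_apply]
      refine Finset.sum_congr rfl fun i _ => ?_
      rw [h5 i, Pi.smul_apply, h3 i, ← hΦa i]
    rw [h2, Pi.sub_apply, h1, Function.const_apply, hwτ, h7]
    have h8 : ‖∑ i, c i • f (Φ i z) - ∑ i, c i • J (mk (Φ i z) • ξ)‖ ≤ ε / 4 := by
      rw [← Finset.sum_sub_distrib]
      refine (norm_sum_le _ _).trans ?_
      calc ∑ i, ‖c i • f (Φ i z) - c i • J (mk (Φ i z) • ξ)‖ ≤ ∑ i, c i * (ε / 4) := by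
            refine Finset.sum_le_sum fun i _ => ?_
            rw [← smul_sub, norm_smul, Real.norm_of_nonneg (hc0 i), norm_sub_rev]
            exact mul_le_mul_of_nonneg_left (hJ _) (hc0 i)
        _ = ε / 4 := by rw [← Finset.sum_mul, hc1, one_mul]
    have h9 : ‖J τ - ∫ y, f y ∂mY‖ ≤ ε / 4 := by
      rw [hτ, ← J.integral_comp_comm horbi, ← integral_sub (J.integrable_comp horbi)
        (integrableOn_univ.1 (hf.continuousOn.integrableOn_compact isCompact_univ))]
      have := norm_integral_le_of_norm_le_const (μ := mY) (ae_of_all _ fun y => hJ y)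
      simpa using this
    have h10 : J (∑ i, c i • (mk (Φ i z) • ξ : Lp E 2 m)) = ∑ i, c i • J (mk (Φ i z) • ξ) := by
      simp only [map_sum, map_smul]
    have h11 := J.le_opNorm (τ - ∑ i, c i • (mk (Φ i z) • ξ : Lp E 2 m))
    set D := τ - ∑ i, c i • (mk (Φ i z) • ξ : Lp E 2 m) with hD
    have h12 : ε ≤ ε / 4 + ‖J D‖ + ε / 4 := by
      refine h6.trans ?_
      have h13 : ∑ i, c i • f (Φ i z) - ∫ y, f y ∂mY =
          (∑ i, c i • f (Φ i z) - ∑ i, c i • J (mk (Φ i z) • ξ)) - J D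
            + (J τ - ∫ y, f y ∂mY) := by
        rw [hD, map_sub, h10]
        abel
      rw [h13]
      refine (norm_add_le _ _).trans (add_le_add ((norm_sub_le _ _).trans ?_) h9)
      exact add_le_add h8 le_rfl
    have h14 : δ ≤ ‖D‖ := by
      by_contra hcon
      have : ‖J‖ * ‖D‖ ≤ ‖J‖ * δ := mul_le_mul_of_nonneg_left (not_le.1 hcon).le hJ0
      linarith
    rw [ENNReal.toReal_ofNat, ENNReal.rpow_ofNat, ← ofReal_norm,
      ← ENNReal.ofReal_pow (norm_nonneg _)]
    exact ENNReal.ofReal_le_ofReal (pow_le_pow_left₀ hδ.le h14 2)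
  have hmeas2 : u {z | ε ≤ ‖∑ i, c i • f (Φ i z) - ∫ y, f y ∂mY‖} ≤ ENNReal.ofReal ε := by
    refine (measure_mono_ae hdiff).trans ?_
    have h1 := Lp.mul_meas_ge_le_pow_enorm (Lp.const 2 u w - v) two_ne_zero
      ENNReal.ofNat_ne_top (ENNReal.ofReal (δ ^ 2))
    rw [← dist_eq_norm, ENNReal.toReal_ofNat] at h1
    have hδ2 : ENNReal.ofReal (δ ^ 2) ≠ 0 := by
      rw [ne_eq, ENNReal.ofReal_eq_zero, not_le]
      positivity
    rw [← ENNReal.mul_le_mul_iff_right hδ2 ENNReal.ofReal_ne_top, ENNReal.toReal_ofNat]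
    refine h1.trans ?_
    rw [ENNReal.rpow_ofNat, ← ENNReal.ofReal_pow dist_nonneg, ← ENNReal.ofReal_mul (by positivity)]
    refine ENNReal.ofReal_le_ofReal ?_
    have h2 : dist (Lp.const 2 u w) v ^ 2 ≤ (δ * min 1 ε) ^ 2 :=
      pow_le_pow_left₀ dist_nonneg hvdist.le 2
    have h3 : (min 1 ε) ^ 2 ≤ ε := by
      have h4 : 0 ≤ min 1 ε := by positivity
      nlinarith [min_le_left 1 ε, min_le_right 1 ε]
    rw [mul_pow] at h2
    exact h2.trans (mul_le_mul_of_nonneg_left h3 (by positivity))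
  let e := Fintype.equivFin ι
  refine ⟨Fintype.card ι, fun i => c (e.symm i), fun i => Φ (e.symm i), fun i => hc0 _, ?_,
    fun i => hΦ _, ?_⟩
  · rw [← hc1]
    exact e.symm.sum_comp c
  · convert hmeas2 using 6 with z
    exact congrArg (· - ∫ y, f y ∂mY) (e.symm.sum_comp fun i => c i • f (Φ i z))

end Averages

end

section

variable {d : ℕ → ℕ} {ω : Ultrafilter ℕ} {G : Type*}
  {σ : ∀ k, G → Equiv.Perm (Fin (d k))}

/-! ### Topological microstates and their lifts -/

section Space

variable {X : Type*} [TopologicalSpace X] [CompactSpace X] [TopologicalSpace.MetrizableSpace X]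
  [MeasurableSpace X] [BorelSpace X] [SMul G X] [ContinuousConstSMul G X]

omit [CompactSpace X] [TopologicalSpace.MetrizableSpace X] [ContinuousConstSMul G X]
  [TopologicalSpace X] [BorelSpace X] in
theorem IsTopMicrostate.congr (hω : IsFree ω) (hd : ∀ k, 0 < d k) {Φ Ψ : LoebSpace d ω → X}
    (hΦ : IsTopMicrostate ω σ Φ) (hΨ : Measurable Ψ) (h : Ψ =ᵐ[loebMeasure d ω] Φ) :
    IsTopMicrostate ω σ Ψ := by
  refine ⟨hΨ, fun g => ?_⟩
  filter_upwards [hΦ.2 g, h, (measurePreserving_permAct hω hd fun k =>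
    σ k g).quasiMeasurePreserving.ae_eq_comp h] with z h1 h2 h3
  rw [h2, ← h1]
  exact h3

/-- Equivariance at `z` says that the ultralimit of the pairs `(φ (σ g j), g • φ j)` lies in the
closed diagonal, to which the dictionary applies. -/
theorem isTopMicrostate_ulimMap_iff (hω : IsFree ω) (hd : ∀ k, 0 < d k)
    {φ : ∀ k, Fin (d k) → X} :
    IsTopMicrostate ω σ (ulimMap ω φ) ↔ ∀ (g : G) (U : Set (X × X)), IsOpen U → diagonal X ⊆ U →
      Tendsto (fun k => unif (d k) {j | (φ k (σ k g j), g • φ k j) ∈ U}) ω (𝓝 1) := by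
  have hpair : ∀ (g : G) (z : LoebSpace d ω),
      ulimMap ω (fun k j => (φ k (σ k g j), g • φ k j)) z ∈ diagonal X ↔
        ulimMap ω φ (permAct ω (fun k => σ k g) z) = g • ulimMap ω φ z := by
    intro g z
    rw [ulimMap_prod (fun k j => φ k (σ k g j)) (fun k j => g • φ k j), ulimMap_permAct,
      ulimMap_comp φ (continuous_const_smul g), mem_diagonal_iff]
  constructor
  · intro h g U hU hdU
    exact tendsto_unif_of_ae_ulimMap_mem hω hd
      ((h.2 g).mono fun z hz => (hpair g z).2 hz) hU hdU
  · intro h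
    refine ⟨measurable_ulimMap φ, fun g => ?_⟩
    have h1 := ae_ulimMap_mem hω hd (f := fun k j => (φ k (σ k g j), g • φ k j))
      isClosed_diagonal (h g)
    exact h1.mono fun z hz => (hpair g z).1 hz

/-- The set of approximate microstates: the points of `X^n` that are `(U, ε)`-equivariant under
`g`. -/
def nearMicrostates {n : ℕ} (s : G → Equiv.Perm (Fin n)) (g : G) (U : Set (X × X))
    (ε : ENNReal) : Set (Fin n → X) :=
  {φ | 1 - ε < unif n {j | (φ (s g j), g • φ j) ∈ U}}

omit [CompactSpace X] [TopologicalSpace.MetrizableSpace X] [BorelSpace X] [MeasurableSpace X]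
  [TopologicalSpace X] [ContinuousConstSMul G X] in
theorem nearMicrostates_mono {n : ℕ} (s : G → Equiv.Perm (Fin n)) (g : G) {U V : Set (X × X)}
    (hUV : U ⊆ V) {ε δ : ENNReal} (h : ε ≤ δ) :
    nearMicrostates s g U ε ⊆ nearMicrostates s g V δ := by
  intro φ hφ
  refine (tsub_le_tsub_left h 1).trans_lt (lt_of_lt_of_le hφ (measure_mono fun j hj => ?_))
  exact hUV hj

theorem measurableSet_nearMicrostates {n : ℕ} (hn : 0 < n) (s : G → Equiv.Perm (Fin n)) (g : G)
    {U : Set (X × X)} (hU : IsOpen U) (ε : ENNReal) :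
    MeasurableSet (nearMicrostates s g U ε) := by
  have := isProbabilityMeasure_unif hn
  have h1 : Measurable fun p : Fin n × (Fin n → X) => (p.2 (s g p.1), g • p.2 p.1) :=
    measurable_from_prod_countable_right fun j => by
      have := (continuous_const_smul (T := X) g).measurable
      exact (measurable_pi_apply (s g j)).prodMk (this.comp (measurable_pi_apply j))
  have h2 : MeasurableSet {p : Fin n × (Fin n → X) | (p.2 (s g p.1), g • p.2 p.1) ∈ U} :=
    h1 hU.measurableSet
  exact measurableSet_lt measurable_const (measurable_measure_prodMk_right h2)

omit [MeasurableSpace X] [BorelSpace X] [SMul G X] [ContinuousConstSMul G X] in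
/-- Approximate equivariance can be tested on countably many conditions. -/
theorem exists_test_sequence [Countable G] [Nonempty G] : ∃ (g : ℕ → G) (U : ℕ → Set (X × X)) (ε : ℕ → ENNReal),
    (∀ n, IsOpen (U n)) ∧ (∀ n, diagonal X ⊆ U n) ∧ (∀ n, 0 < ε n) ∧
    ∀ (h : G) (V : Set (X × X)) (δ : ENNReal), IsOpen V → diagonal X ⊆ V → 0 < δ →
      ∃ n, g n = h ∧ U n ⊆ V ∧ ε n ≤ δ := by
  obtain ⟨O, F, hO, hF, hCO, hOF, hFC⟩ := exists_seq_closed_nhds (isClosed_diagonal (X := X))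
  obtain ⟨e, he⟩ := exists_surjective_nat (G × (Finset ℕ × ℕ))
  refine ⟨fun n => (e n).1, fun n => ⋂ i ∈ (e n).2.1, O i,
    fun n => (((e n).2.2 : ENNReal) + 1)⁻¹, fun n => isOpen_biInter_finset fun i _ => hO i,
    fun n => subset_iInter₂ fun i _ => hCO i, fun n => by simp, fun h V δ hV hdV hδ => ?_⟩
  -- By compactness finitely many of the closed neighbourhoods already shrink the diagonal into `V`;
  -- there are only countably many finite index sets.
  have h1 : ∃ t : Finset ℕ, ⋂ i ∈ t, F i ⊆ V := by
    obtain ⟨t, ht⟩ := hV.isClosed_compl.isCompact.elim_finite_subfamily_closed F hF (by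
      rw [hFC, ← disjoint_iff_inter_eq_empty]
      exact disjoint_compl_left_iff_subset.2 hdV)
    refine ⟨t, ?_⟩
    rw [← disjoint_iff_inter_eq_empty] at ht
    exact disjoint_compl_left_iff_subset.1 ht
  obtain ⟨t, ht⟩ := h1
  obtain ⟨m, hm⟩ := ENNReal.exists_inv_nat_lt hδ.ne'
  obtain ⟨n, hn⟩ := he (h, t, m)
  refine ⟨n, by simp only [hn], ?_, ?_⟩
  · simp only [hn]
    exact (iInter₂_mono fun i _ => hOF i).trans ht
  · simp only [hn]
    exact (ENNReal.inv_le_inv.2 le_self_add).trans hm.le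

theorem tendsto_one_of_forall_eventually {l : Filter ℕ} {x : ℕ → ENNReal} (hx : ∀ k, x k ≤ 1)
    (h : ∀ ε : ENNReal, 0 < ε → ∀ᶠ k in l, 1 - ε ≤ x k) : Tendsto x l (𝓝 1) := by
  refine tendsto_order.2 ⟨fun a ha => ?_, fun a ha => Eventually.of_forall fun k => (hx k).trans_lt ha⟩
  obtain ⟨b, hab, hb1⟩ := exists_between ha
  filter_upwards [h (1 - b) (tsub_pos_of_lt hb1)] with k hk
  rw [ENNReal.sub_sub_cancel ENNReal.one_ne_top hb1.le] at hk
  exact hab.trans_le hk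

end Space

/-! ### Convex combinations of point masses -/

section Combination

variable {Ω : Type*} [MeasurableSpace Ω] {ι : Type*} [Fintype ι] {c : ι → ℝ}

/-- A convex combination of point masses. -/
noncomputable def diracCombination (hc0 : ∀ i, 0 ≤ c i) (hc1 : ∑ i, c i = 1) (x : ι → Ω) :
    ProbabilityMeasure Ω :=
  ⟨∑ i, ENNReal.ofReal (c i) • Measure.dirac (x i), ⟨by
    simp only [Measure.coe_finsetSum, Finset.sum_apply, Measure.smul_apply, measure_univ,
      smul_eq_mul, mul_one]
    rw [← ENNReal.ofReal_sum_of_nonneg fun i _ => hc0 i, hc1, ENNReal.ofReal_one]⟩⟩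

theorem coe_diracCombination (hc0 : ∀ i, 0 ≤ c i) (hc1 : ∑ i, c i = 1) (x : ι → Ω) :
    (diracCombination hc0 hc1 x : Measure Ω) =
      ∑ i, ENNReal.ofReal (c i) • Measure.dirac (x i) := rfl

theorem diracCombination_eq_one (hc0 : ∀ i, 0 ≤ c i) (hc1 : ∑ i, c i = 1) {x : ι → Ω}
    {S : Set Ω} (h : ∀ i, x i ∈ S) : (diracCombination hc0 hc1 x : Measure Ω) S = 1 := by
  rw [coe_diracCombination]
  simp only [Measure.coe_finsetSum, Finset.sum_apply, Measure.smul_apply,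
    Measure.dirac_apply_of_mem (h _), smul_eq_mul, mul_one]
  rw [← ENNReal.ofReal_sum_of_nonneg fun i _ => hc0 i, hc1, ENNReal.ofReal_one]

theorem marginal_diracCombination {n : ℕ} (hc0 : ∀ i, 0 ≤ c i) (hc1 : ∑ i, c i = 1)
    (x : ι → Fin n → Ω) (j : Fin n) :
    marginal (diracCombination hc0 hc1 x) j = diracCombination hc0 hc1 fun i => x i j := by
  refine Subtype.ext ?_
  change (∑ i, ENNReal.ofReal (c i) • Measure.dirac (x i)).map (fun y : Fin n → Ω => y j) =
    ∑ i, ENNReal.ofReal (c i) • Measure.dirac (x i j)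
  rw [Measure.map_finset_sum (measurable_pi_apply j).aemeasurable]
  refine Finset.sum_congr rfl fun i _ => ?_
  rw [Measure.map_smul]
  exact congrArg _ (Measure.map_dirac' (measurable_pi_apply j) (x i))

theorem integral_diracCombination [TopologicalSpace Ω] [CompactSpace Ω] [OpensMeasurableSpace Ω]
    [TopologicalSpace.MetrizableSpace Ω]
    {E : Type*} [NormedAddCommGroup E] [NormedSpace ℝ E] [CompleteSpace E]
    (hc0 : ∀ i, 0 ≤ c i) (hc1 : ∑ i, c i = 1)
    (x : ι → Ω) {f : Ω → E} (hf : Continuous f) :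
    ∫ y, f y ∂(diracCombination hc0 hc1 x : Measure Ω) = ∑ i, c i • f (x i) := by
  have hfi : ∀ i, Integrable f (Measure.dirac (x i)) := fun i =>
    integrableOn_univ.1 (hf.continuousOn.integrableOn_compact' isCompact_univ MeasurableSet.univ)
  rw [coe_diracCombination, integral_finsetSum_measure fun i _ =>
    (hfi i).smul_measure ENNReal.ofReal_ne_top]
  refine Finset.sum_congr rfl fun i _ => ?_
  rw [integral_smul_measure, ENNReal.toReal_ofReal (hc0 i),
    integral_dirac' _ _ (hf.stronglyMeasurable_of_hasCompactSupport (.of_compactSpace f))]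

theorem continuous_diracCombination [TopologicalSpace Ω] [CompactSpace Ω] [OpensMeasurableSpace Ω]
    [TopologicalSpace.MetrizableSpace Ω]
    (hc0 : ∀ i, 0 ≤ c i) (hc1 : ∑ i, c i = 1) :
    Continuous fun x : ι → Ω => diracCombination hc0 hc1 x := by
  rw [ProbabilityMeasure.continuous_iff_forall_continuousMap_continuous_integral]
  intro f
  simp only [integral_diracCombination hc0 hc1 _ f.continuous]
  fun_prop

end Combination

/-- Weak* neighbourhoods are defined by the integral of one vector valued function. -/
theorem exists_norm_integral_sub_lt_mem {X : Type*} [TopologicalSpace X] [CompactSpace X]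
    [TopologicalSpace.MetrizableSpace X] [MeasurableSpace X] [BorelSpace X]
    {m : ProbabilityMeasure X} {O : Set (ProbabilityMeasure X)} (hO : O ∈ 𝓝 m) :
    ∃ (I : Set (BoundedContinuousFunction X ℝ)) (_ : Fintype I) (f : X → EuclideanSpace ℝ I)
      (ε : ℝ), Continuous f ∧ 0 < ε ∧ ∀ m' : ProbabilityMeasure X,
        ‖∫ x, f x ∂(m' : Measure X) - ∫ x, f x ∂(m : Measure X)‖ < ε → m' ∈ O := by
  -- `l` is the coarsest filter along which all integrals converge to those of `m`. Hence `O` is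
  -- controlled by finitely many test functions, which are bundled into one map to a Euclidean space
  -- to suit the Hilbert space argument.
  let l : Filter (ProbabilityMeasure X) := ⨅ f : BoundedContinuousFunction X ℝ,
    comap (fun m' : ProbabilityMeasure X => ∫ x, f x ∂(m' : Measure X))
      (𝓝 (∫ x, f x ∂(m : Measure X)))
  have hl : Tendsto id l (𝓝 m) := ProbabilityMeasure.tendsto_iff_forall_integral_tendsto.2
    fun f => tendsto_iff_comap.2 (iInf_le _ f)
  have hOl : O ∈ l := hl hO
  obtain ⟨I, hI, V, hV, rfl⟩ := Filter.mem_iInf.1 hOl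
  have hball : ∀ i : I, ∃ ε : ℝ, 0 < ε ∧ ∀ m' : ProbabilityMeasure X,
      |∫ x, i.1 x ∂(m' : Measure X) - ∫ x, i.1 x ∂(m : Measure X)| < ε → m' ∈ V i := by
    intro i
    obtain ⟨t, ht, htV⟩ := mem_comap.1 (hV i)
    obtain ⟨ε, hε, hεt⟩ := Metric.mem_nhds_iff.1 ht
    exact ⟨ε, hε, fun m' hm' => htV (hεt hm')⟩
  choose δ hδ hδV using hball
  have : Finite I := hI
  have : Fintype I := hI.fintype
  have hev : ∀ᶠ ε : ℝ in 𝓝[>] 0, ∀ i : I, ε < δ i :=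
    eventually_all.2 fun i => eventually_nhdsWithin_of_eventually_nhds (eventually_lt_nhds (hδ i))
  obtain ⟨ε, hε, hε0⟩ := (hev.and self_mem_nhdsWithin).exists
  have hfc : Continuous fun x => (WithLp.toLp 2 fun i : I => i.1 x : EuclideanSpace ℝ I) :=
    (PiLp.continuous_toLp 2 _).comp (continuous_pi fun i => i.1.continuous)
  refine ⟨I, inferInstance, fun x => WithLp.toLp 2 fun i => i.1 x, ε, hfc, hε0, fun m' hm' => ?_⟩
  refine mem_iInter.2 fun i => hδV i m' ?_
  have hcoord : ∀ ν : ProbabilityMeasure X,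
      (∫ x, (WithLp.toLp 2 fun i : I => i.1 x : EuclideanSpace ℝ I) ∂(ν : Measure X)) i =
        ∫ x, i.1 x ∂(ν : Measure X) := fun ν =>
    ((EuclideanSpace.proj (𝕜 := ℝ) i).integral_comp_comm
      (integrableOn_univ.1 (hfc.continuousOn.integrableOn_compact isCompact_univ))).symm
  rw [← hcoord m', ← hcoord m, ← PiLp.sub_apply, ← Real.norm_eq_abs]
  exact (PiLp.norm_apply_le _ i).trans_lt (hm'.trans (hε i))

/-! ### Marginals of measures on microstates -/

section Marginals

variable {X : Type*} [TopologicalSpace X] [CompactSpace X] [TopologicalSpace.MetrizableSpace X]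
  [MeasurableSpace X] [BorelSpace X] [SMul G X] [ContinuousConstSMul G X]

-- This is the dictionary for the compact metrizable space `Prob(X)` and the closed set `{m}`.
omit [SMul G X] [ContinuousConstSMul G X] in
theorem locallyWeakStarTendsto_iff (hω : IsFree ω) (hd : ∀ k, 0 < d k)
    {μ : ∀ k, ProbabilityMeasure (Fin (d k) → X)} {m : ProbabilityMeasure X} :
    LocallyWeakStarTendsto ω μ m ↔ ∀ᵐ z ∂(loebMeasure d ω), marginalLimit ω μ z = m := by
  constructor
  · intro h
    exact ae_ulimMap_mem hω hd (C := {m}) isClosed_singleton fun O hO hmO =>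
      h O (hO.mem_nhds (hmO rfl))
  · intro h O hO
    obtain ⟨U, hUO, hU, hmU⟩ := mem_nhds_iff.1 hO
    have h1 := tendsto_unif_of_ae_ulimMap_mem hω hd (f := fun k => marginal (μ k)) (C := {m})
      h hU (singleton_subset_iff.2 hmU)
    have := fun k => isProbabilityMeasure_unif (hd k)
    exact tendsto_of_tendsto_of_tendsto_of_le_of_le h1 tendsto_const_nhds
      (fun k => measure_mono fun j hj => hUO hj) fun k => prob_le_one

theorem isTopMicrostate_ulimMap_of_tests (hω : IsFree ω) (hd : ∀ k, 0 < d k)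
    {g : ℕ → G} {U : ℕ → Set (X × X)} {ε : ℕ → ENNReal}
    (htest : ∀ (h : G) (V : Set (X × X)) (δ : ENNReal), IsOpen V → diagonal X ⊆ V → 0 < δ →
      ∃ n, g n = h ∧ U n ⊆ V ∧ ε n ≤ δ) {φ : ∀ k, Fin (d k) → X}
    (h : ∀ n, ∀ᶠ k in (ω : Filter ℕ), φ k ∈ nearMicrostates (σ k) (g n) (U n) (ε n)) :
    IsTopMicrostate ω σ (ulimMap ω φ) := by
  have := fun k => isProbabilityMeasure_unif (hd k)
  refine (isTopMicrostate_ulimMap_iff hω hd).2 fun g V hV hdV => ?_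
  refine tendsto_one_of_forall_eventually (fun k => prob_le_one) fun δ hδ => ?_
  obtain ⟨n, rfl, hUV, hεδ⟩ := htest g V δ hV hdV hδ
  filter_upwards [h n] with k hk
  exact le_of_lt (nearMicrostates_mono (σ k) _ hUV hεδ hk)

/-- The marginal limits of measures on microstates are supported on every closed set that absorbs
all microstates. -/
theorem ae_marginalLimit_mem [Countable G] [Nonempty G] (hω : IsFree ω) (hd : ∀ k, 0 < d k)
    {μ : ∀ k, ProbabilityMeasure (Fin (d k) → X)} (hμ : AsympSupported ω σ μ) {Y : Set X}
    (hY : IsClosed Y) (hYne : Y.Nonempty) (habs : Absorbs ω σ Y) :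
    ∀ᵐ z ∂(loebMeasure d ω), ∀ᵐ x ∂(marginalLimit ω μ z : Measure X), x ∈ Y := by
  let _ := TopologicalSpace.metrizableSpaceMetric X
  have := isProbabilityMeasure_loebMeasure hω hd
  have hunif := fun k => isProbabilityMeasure_unif (hd k)
  -- The truncated distance is continuous, bounded by `1` and vanishes exactly on `Y`, so its
  -- integral detects mass outside `Y`.
  let f : X → NNReal := fun x => min 1 (Metric.infNndist x Y)
  have hf : Continuous f := continuous_const.min (Metric.continuous_infNndist_pt Y)
  have hf1 : ∀ x, f x ≤ 1 := fun x => min_le_left _ _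
  have hf0 : ∀ x, f x = 0 ↔ x ∈ Y := fun x => by
    rw [hY.mem_iff_infDist_zero hYne, ← Metric.coe_infNndist, NNReal.coe_eq_zero]
    simp only [f, min_eq_iff, one_ne_zero, false_and, false_or, and_iff_left_iff_imp]
    exact fun h => h.le.trans zero_le_one
  let I : ProbabilityMeasure X → ENNReal := fun ν => ∫⁻ x, f x ∂(ν : Measure X)
  have hI : Continuous I :=
    ProbabilityMeasure.continuous_lintegral_continuousMap (⟨f, hf⟩ : C(X, NNReal))
  have hfm : Measurable fun x => (f x : ENNReal) := hf.measurable.coe_nnreal_ennreal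
  obtain ⟨g, U, ε, hU, hdU, hε, htest⟩ := exists_test_sequence (G := G) (X := X)
  by_contra hcon
  obtain ⟨c, hc0, hc⟩ : ∃ c : ENNReal, 0 < c ∧
      0 < loebMeasure d ω {z | c < I (marginalLimit ω μ z)} := by
    by_contra! hall
    have h1 : ∀ n : ℕ, ∀ᵐ z ∂(loebMeasure d ω),
        I (marginalLimit ω μ z) ≤ ((n : ENNReal) + 1)⁻¹ := fun n => by
      have h2 := le_antisymm (hall ((n : ENNReal) + 1)⁻¹ (by simp)) bot_le
      filter_upwards [measure_eq_zero_iff_ae_notMem.1 h2] with z hz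
      simpa using hz
    refine hcon ?_
    filter_upwards [ae_all_iff.2 h1] with z hz
    have h3 : I (marginalLimit ω μ z) = 0 :=
      le_antisymm (ge_of_tendsto' tendsto_inv_nat_add_one hz) bot_le
    rw [lintegral_eq_zero_iff hfm] at h3
    filter_upwards [h3] with x hx
    exact (hf0 x).1 (by simpa using hx)
  obtain ⟨b, hb0, hb⟩ := exists_between hc
  have hb1 : b ≠ ⊤ := (hb.trans_le prob_le_one).ne_top
  have hfreq : ∀ᶠ k in (ω : Filter ℕ), b < unif (d k) {j | c < I (marginal (μ k) j)} := by
    have h1 : {z | c < I (marginalLimit ω μ z)} ⊆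
        internalSet ω fun k => {j | c < I (marginal (μ k) j)} :=
      ulimMap_preimage_subset_internalSet (fun k => marginal (μ k))
        (isOpen_lt continuous_const hI)
    exact (tendsto_unif_internalSet hω hd _).eventually_const_lt (hb.trans_le (measure_mono h1))
  -- The `μ k`-mean of the average of `f` over coordinates is at least `c * b`. If every approximate
  -- microstate had `f ≥ r` on a proportion less than `r`, this mean would be at most `2 * r` plus
  -- the mass `r` of the remaining points.
  obtain ⟨r, hr0, hrc⟩ : ∃ r : ENNReal, 0 < r ∧ 3 * r < c * b := by
    have h1 : 0 < c * b := ENNReal.mul_pos hc0.ne' hb0.ne'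
    have h2 : Tendsto (fun r : ENNReal => 3 * r) (𝓝 0) (𝓝 (3 * 0)) :=
      ENNReal.Tendsto.const_mul tendsto_id (Or.inr ENNReal.ofNat_ne_top)
    rw [mul_zero] at h2
    have h3 : ∀ᶠ r in 𝓝[>] (0 : ENNReal), 3 * r < c * b :=
      eventually_nhdsWithin_of_eventually_nhds (h2.eventually_lt_const h1)
    obtain ⟨r, hr, hr'⟩ := (h3.and self_mem_nhdsWithin).exists
    exact ⟨r, hr', hr⟩
  have hmean : ∀ k, ∫⁻ φ, ∫⁻ j, f (φ j) ∂(unif (d k)) ∂(μ k : Measure (Fin (d k) → X)) =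
      ∫⁻ j, I (marginal (μ k) j) ∂(unif (d k)) := by
    intro k
    rw [lintegral_lintegral_swap]
    · refine lintegral_congr fun j => ?_
      exact (lintegral_map hfm (measurable_pi_apply j)).symm
    · exact (measurable_from_prod_countable_left fun j =>
        hfm.comp (measurable_pi_apply j)).aemeasurable
  have hP : ∀ n, ∀ᶠ k in (ω : Filter ℕ), ∃ φ : Fin (d k) → X,
      (∀ i ∈ Finset.range (n + 1), φ ∈ nearMicrostates (σ k) (g i) (U i) (ε i)) ∧
        r ≤ unif (d k) {j | r ≤ f (φ j)} := by
    intro n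
    have hsum : Tendsto (fun k => ∑ i ∈ Finset.range (n + 1),
        (μ k : Measure (Fin (d k) → X)) (nearMicrostates (σ k) (g i) (U i) (ε i))ᶜ) ω (𝓝 0) := by
      rw [← Finset.sum_const_zero (s := Finset.range (n + 1))]
      refine tendsto_finsetSum _ fun i _ => ?_
      have h1 := ENNReal.Tendsto.sub (tendsto_const_nhds (x := (1 : ENNReal)))
        (hμ (g i) (U i) (hU i) (hdU i) (ε i) (hε i)) (Or.inl ENNReal.one_ne_top)
      rw [tsub_self] at h1
      refine h1.congr fun k => ?_
      exact (prob_compl_eq_one_sub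
        (measurableSet_nearMicrostates (hd k) (σ k) (g i) (hU i) (ε i))).symm
    filter_upwards [hfreq, hsum.eventually_lt_const hr0] with k hk1 hk2
    by_contra! hno
    set B : Set (Fin (d k) → X) :=
      ⋃ i ∈ Finset.range (n + 1), (nearMicrostates (σ k) (g i) (U i) (ε i))ᶜ with hB
    have hBm : MeasurableSet B := Finset.measurableSet_biUnion _ fun i _ =>
      (measurableSet_nearMicrostates (hd k) (σ k) (g i) (hU i) (ε i)).compl
    have hBr : (μ k : Measure (Fin (d k) → X)) B ≤ r :=
      (measure_biUnion_finset_le _ _).trans hk2.le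
    have hle : ∀ φ : Fin (d k) → X,
        ∫⁻ j, f (φ j) ∂(unif (d k)) ≤ 2 * r + B.indicator 1 φ := by
      intro φ
      by_cases hφ : φ ∈ B
      · rw [indicator_of_mem hφ]
        refine le_trans ?_ le_add_self
        calc ∫⁻ j, f (φ j) ∂(unif (d k)) ≤ ∫⁻ _, 1 ∂(unif (d k)) :=
              lintegral_mono fun j => ENNReal.coe_le_one_iff.2 (hf1 (φ j))
          _ = 1 := by simp
      · rw [indicator_of_notMem hφ, add_zero, two_mul]
        have h1 := hno φ fun i hi => by
          by_contra hcon'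
          exact hφ (mem_biUnion hi hcon')
        have h2 : ∀ j, (f (φ j) : ENNReal) ≤ r + {j | r ≤ (f (φ j) : ENNReal)}.indicator 1 j := by
          intro j
          by_cases hj : r ≤ (f (φ j) : ENNReal)
          · rw [indicator_of_mem (show j ∈ {j | r ≤ (f (φ j) : ENNReal)} from hj)]
            exact le_trans (ENNReal.coe_le_one_iff.2 (hf1 (φ j))) le_add_self
          · exact (not_le.1 hj).le.trans le_self_add
        calc ∫⁻ j, f (φ j) ∂(unif (d k))
            ≤ ∫⁻ j, (r + {j | r ≤ (f (φ j) : ENNReal)}.indicator 1 j) ∂(unif (d k)) :=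
              lintegral_mono h2
          _ = r + unif (d k) {j | r ≤ (f (φ j) : ENNReal)} := by
              rw [lintegral_add_left measurable_const, lintegral_const, measure_univ, mul_one,
                lintegral_indicator_one (MeasurableSet.of_discrete)]
          _ ≤ r + r := by gcongr
    have h3 : ∫⁻ φ, ∫⁻ j, f (φ j) ∂(unif (d k)) ∂(μ k : Measure (Fin (d k) → X)) ≤ 3 * r := by
      calc _ ≤ ∫⁻ φ, (2 * r + B.indicator 1 φ) ∂(μ k : Measure (Fin (d k) → X)) :=
            lintegral_mono hle
        _ = 2 * r + (μ k : Measure (Fin (d k) → X)) B := by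
            rw [lintegral_add_left measurable_const, lintegral_const, measure_univ, mul_one,
              lintegral_indicator_one hBm]
        _ ≤ 2 * r + r := by gcongr
        _ = 3 * r := by ring
    have h4 : c * b ≤ ∫⁻ j, I (marginal (μ k) j) ∂(unif (d k)) := by
      calc c * b ≤ c * unif (d k) {j | c ≤ I (marginal (μ k) j)} := by
            gcongr
            exact hk1.le.trans (measure_mono fun j (hj : c < _) => hj.le)
        _ ≤ _ := mul_meas_ge_le_lintegral (measurable_of_finite _) c
    rw [← hmean k] at h4
    exact absurd (h4.trans h3) (not_le.2 hrc)
  have : Nonempty X := ⟨hYne.some⟩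
  -- The diagonal sequence passes ever more tests, so its ultralimit is a genuine microstate, while
  -- `f ≥ r` persists on a set of measure at least `r`. This contradicts absorption.
  obtain ⟨N, φ, hN, hφ⟩ := hω.exists_diagonal_seq hP
  have hmic : IsTopMicrostate ω σ (ulimMap ω φ) := by
    refine isTopMicrostate_ulimMap_of_tests hω hd htest fun n => ?_
    filter_upwards [hφ, hN.eventually_ge_atTop n] with k h1 h2
    exact h1.1 n (Finset.mem_range.2 (by omega))
  have hsub : internalSet ω (fun k => {j | r ≤ (f (φ k j) : ENNReal)}) ⊆
      {z | r ≤ (f (ulimMap ω φ z) : ENNReal)} :=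
    internalSet_subset_ulimMap_preimage φ
      (isClosed_le continuous_const (ENNReal.continuous_coe.comp hf))
  have hpos : r ≤ loebMeasure d ω (internalSet ω fun k => {j | r ≤ (f (φ k j) : ENNReal)}) :=
    ge_of_tendsto (tendsto_unif_internalSet hω hd _) (hφ.mono fun k hk => hk.2)
  have hzero : loebMeasure d ω {z | r ≤ (f (ulimMap ω φ z) : ENNReal)} = 0 := by
    rw [measure_eq_zero_iff_ae_notMem]
    filter_upwards [habs _ hmic] with z hz
    have h1 := (hf0 _).2 hz
    simp only [h1, ENNReal.coe_zero, not_le]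
    exact hr0
  exact hr0.not_ge (hpos.trans ((measure_mono hsub).trans hzero.le))

end Marginals

end

section

variable {d : ℕ → ℕ} {ω : Ultrafilter ℕ} {G : Type*}
  {σ : ∀ k, G → Equiv.Perm (Fin (d k))}

/-! ### The group of topological microstates -/

/-- Elements of the centralizer commute with `σ_ω(g)` only in the metric ultraproduct, so the two
orders of composition agree almost everywhere, which is enough. -/
theorem IsTopMicrostate.comp_permAct {X : Type*} [MeasurableSpace X] [SMul G X]
    (hω : IsFree ω) (hd : ∀ k, 0 < d k) {Φ : LoebSpace d ω → X} (hΦ : IsTopMicrostate ω σ Φ) {p : ∀ k, Equiv.Perm (Fin (d k))}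
    (hp : (p : UltraSym d ω) ∈ soficCentralizer ω σ) :
    IsTopMicrostate ω σ (Φ ∘ permAct ω p) := by
  refine ⟨hΦ.1.comp (measurable_permAct p), fun g => ?_⟩
  have h1 : (((fun k => σ k g) * p : ∀ k, Equiv.Perm (Fin (d k))) : UltraSym d ω) =
      ((p * fun k => σ k g : ∀ k, Equiv.Perm (Fin (d k))) : UltraSym d ω) :=
    Subgroup.mem_centralizer_iff.1 hp _ ⟨g, rfl⟩
  filter_upwards [permAct_ae_eq hω hd h1,
    (measurePreserving_permAct hω hd p).quasiMeasurePreserving.ae (hΦ.2 g)] with z h2 h3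
  rw [permAct_mul, permAct_mul] at h2
  rw [Function.comp_apply, ← h2, h3, Function.comp_apply]

section Group

variable [Group G] {X : Type*} [Group X] [TopologicalSpace X] [IsTopologicalGroup X] [CompactSpace X]
  [TopologicalSpace.MetrizableSpace X] [MeasurableSpace X] [BorelSpace X]
  [MulDistribMulAction G X]

omit [CompactSpace X] [TopologicalSpace.MetrizableSpace X] [BorelSpace X]
  [IsTopologicalGroup X] [TopologicalSpace X] in
theorem isTopMicrostate_one : IsTopMicrostate ω σ (1 : LoebSpace d ω → X) :=
  ⟨measurable_const, fun g => ae_of_all _ fun _ => (smul_one g).symm⟩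

theorem IsTopMicrostate.mul {Φ Ψ : LoebSpace d ω → X} (hΦ : IsTopMicrostate ω σ Φ)
    (hΨ : IsTopMicrostate ω σ Ψ) : IsTopMicrostate ω σ (Φ * Ψ) := by
  refine ⟨hΦ.1.mul hΨ.1, fun g => ?_⟩
  filter_upwards [hΦ.2 g, hΨ.2 g] with z h1 h2
  rw [Pi.mul_apply, Pi.mul_apply, h1, h2, smul_mul']

variable (X) in
/-- The smallest closed subgroup that absorbs all topological microstates. -/
def absorbingSubgroup (ω : Ultrafilter ℕ) (σ : ∀ k, G → Equiv.Perm (Fin (d k))) :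
    ClosedSubgroup X where
  carrier := ⋂ H : {H : ClosedSubgroup X // Absorbs ω σ (H : Set X)}, (H.1 : Set X)
  mul_mem' ha hb := mem_iInter.2 fun H => mul_mem (mem_iInter.1 ha H) (mem_iInter.1 hb H)
  one_mem' := mem_iInter.2 fun H => one_mem H.1
  inv_mem' ha := mem_iInter.2 fun H => inv_mem (mem_iInter.1 ha H)
  isClosed' := isClosed_iInter fun H => H.1.isClosed'

omit [IsTopologicalGroup X] [CompactSpace X] [TopologicalSpace.MetrizableSpace X]
  [BorelSpace X] in
theorem coe_absorbingSubgroup :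
    (absorbingSubgroup X ω σ : Set X) =
      ⋂ H : {H : ClosedSubgroup X // Absorbs ω σ (H : Set X)}, (H.1 : Set X) := rfl

omit [IsTopologicalGroup X] [CompactSpace X] [TopologicalSpace.MetrizableSpace X]
  [BorelSpace X] in
theorem absorbingSubgroup_le {H : ClosedSubgroup X} (hH : Absorbs ω σ (H : Set X)) :
    absorbingSubgroup X ω σ ≤ H := fun _ hx => mem_iInter.1 hx ⟨H, hH⟩

-- The defining intersection may be uncountable. Second countability of `X` replaces the union of
-- the open complements by a countable one, and countably many null sets can be discarded.
omit [IsTopologicalGroup X] [BorelSpace X] in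
theorem absorbs_absorbingSubgroup : Absorbs ω σ (absorbingSubgroup X ω σ : Set X) := by
  intro Φ hΦ
  obtain ⟨T, hT, hTU⟩ := TopologicalSpace.isOpen_iUnion_countable
    (fun H : {H : ClosedSubgroup X // Absorbs ω σ (H : Set X)} => (H.1 : Set X)ᶜ)
    fun H => H.1.isClosed'.isOpen_compl
  have h1 : ∀ᵐ z ∂(loebMeasure d ω), ∀ H ∈ T, Φ z ∈ (H.1 : Set X) :=
    (ae_ball_iff hT).2 fun H _ => H.2 Φ hΦ
  filter_upwards [h1] with z hz
  rw [coe_absorbingSubgroup, ← compl_compl (⋂ H : {H : ClosedSubgroup X // _}, (H.1 : Set X)),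
    compl_iInter, ← hTU, mem_compl_iff, mem_iUnion₂]
  rintro ⟨H, hH, hzH⟩
  exact hzH (hz H hH)

-- The preimage of the absorbing subgroup under `g` is a closed subgroup which also absorbs, because
-- `gΦ = Φ ∘ σ_ω(g)` almost everywhere and `σ_ω(g)` preserves null sets. Minimality gives the
-- inclusion.
omit [IsTopologicalGroup X] [BorelSpace X] in
theorem gInvariant_absorbingSubgroup [ContinuousConstSMul G X] (hω : IsFree ω)
    (hd : ∀ k, 0 < d k) : GInvariant G (absorbingSubgroup X ω σ) := by
  intro g
  let H : ClosedSubgroup X :=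
    { carrier := {x | g • x ∈ absorbingSubgroup X ω σ}
      mul_mem' := fun {a b} ha hb => by
        rw [mem_ofPred_eq, smul_mul']
        exact mul_mem ha hb
      one_mem' := by
        rw [mem_ofPred_eq, smul_one]
        exact one_mem _
      inv_mem' := fun {a} ha => by
        rw [mem_ofPred_eq, smul_inv']
        exact inv_mem ha
      isClosed' := (absorbingSubgroup X ω σ).isClosed'.preimage (continuous_const_smul g) }
  have hH : Absorbs ω σ (H : Set X) := by
    intro Φ hΦ
    filter_upwards [hΦ.2 g, (measurePreserving_permAct hω hd fun k =>
      σ k g).quasiMeasurePreserving.ae (absorbs_absorbingSubgroup Φ hΦ)] with z h1 h2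
    rw [h1] at h2
    exact h2
  exact fun x hx => absorbingSubgroup_le hH hx

/-- If the centralizer acts ergodically, then the Haar measure of the smallest absorbing subgroup
is a local weak* limit of measures on topological microstates. -/
theorem isLocalWeakStarLimit_absorbingSubgroup [Countable G] [ContinuousConstSMul G X]
    (hω : IsFree ω) (hd : ∀ k, 0 < d k) (herg : HasErgodicCentralizer ω σ) :
    IsLocalWeakStarLimit ω σ (haarSub (absorbingSubgroup X ω σ)) := by
  have := isProbabilityMeasure_loebMeasure hω hd
  have hunif := fun k => isProbabilityMeasure_unif (hd k)
  set Y := absorbingSubgroup X ω σ with hY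
  obtain ⟨g, U, ε, hU, hdU, hε, htest⟩ := exists_test_sequence (G := G) (X := X)
  obtain ⟨O, hO⟩ := (𝓝 (haarSub Y)).exists_antitone_basis
  -- At stage `n` the measure lives entirely on points passing the first `n + 1` tests, and all but
  -- a proportion `1 / (n + 1)` of its marginals lie in the basic neighbourhood `O n`.
  have hP : ∀ n, ∀ᶠ k in (ω : Filter ℕ), ∃ μ : ProbabilityMeasure (Fin (d k) → X),
      (∀ i ∈ Finset.range (n + 1),
        (μ : Measure (Fin (d k) → X)) (nearMicrostates (σ k) (g i) (U i) (ε i)) = 1) ∧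
      1 - ((n : ENNReal) + 1)⁻¹ < unif (d k) {j | marginal μ j ∈ O n} := by
    intro n
    obtain ⟨V, hVO, hV, hYV⟩ := mem_nhds_iff.1 (hO.mem n)
    obtain ⟨I, _, f, δ, hf, hδ, hfδ⟩ := exists_norm_integral_sub_lt_mem (hV.mem_nhds hYV)
    have hn : (0 : ℝ) < ((n : ℝ) + 1)⁻¹ / 2 := by positivity
    obtain ⟨N, c, Φ, hc0, hc1, hΦ, hclose⟩ := exists_convexCombination_close_haarSub
      (u := loebMeasure d ω) (M := {Φ : LoebSpace d ω → X | IsTopMicrostate ω σ Φ})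
      ⟨1, isTopMicrostate_one⟩ (fun Φ h => h.1) (fun Φ hΦ Ψ hΨ => hΦ.mul hΨ)
      (Γ := {P | ∃ p : ∀ k, Equiv.Perm (Fin (d k)),
        (p : UltraSym d ω) ∈ soficCentralizer ω σ ∧ permAct ω p = P})
      (by
        rintro _ ⟨p, -, rfl⟩
        exact measurePreserving_permAct hω hd p)
      (by
        rintro Φ hΦ _ ⟨p, hp, rfl⟩
        exact hΦ.comp_permAct hω hd hp)
      (fun S hS hinv => herg S hS fun p hp => hinv _ ⟨p, hp, rfl⟩) (Y := Y)
      (fun Φ hΦ => absorbs_absorbingSubgroup Φ hΦ)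
      -- The tolerance plays two roles: below `δ` it places the combination in `V`, and below half
      -- of `1 / (n + 1)` it makes the bound on the exceptional set strict.
      (fun H hH => absorbingSubgroup_le fun Φ hΦ => hH Φ hΦ) hf (lt_min hδ hn)
    choose φ hφ using fun i => exists_lift hω hd (hΦ i).1
    have hmic : ∀ i, IsTopMicrostate ω σ (ulimMap ω (φ i)) := fun i =>
      (hΦ i).congr hω hd (measurable_ulimMap _) (hφ i)
    have hnear : ∀ᶠ k in (ω : Filter ℕ), ∀ l, ∀ i ∈ Finset.range (n + 1),
        φ l k ∈ nearMicrostates (σ k) (g i) (U i) (ε i) :=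
      eventually_all.2 fun l => (Finset.eventually_all _).2 fun i _ =>
        ((isTopMicrostate_ulimMap_iff hω hd).1 (hmic l) (g i) (U i) (hU i)
          (hdU i)).eventually_const_lt (ENNReal.sub_lt_self ENNReal.one_ne_top one_ne_zero (hε i).ne')
    let κ : (Fin N → X) → ProbabilityMeasure X := diracCombination hc0 hc1
    have hκ : Continuous κ := continuous_diracCombination hc0 hc1
    have hlarge : 1 - ((n : ENNReal) + 1)⁻¹ <
        loebMeasure d ω (internalSet ω fun k => {j | κ (fun i => φ i k j) ∈ V}) := by
      have hsub : {z | ulimMap ω (fun k j => κ fun i => φ i k j) z ∈ V} ⊆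
          internalSet ω fun k => {j | κ (fun i => φ i k j) ∈ V} :=
        ulimMap_preimage_subset_internalSet (fun k j => κ fun i => φ i k j) hV
      have hbad : {z | ulimMap ω (fun k j => κ fun i => φ i k j) z ∈ V}ᶜ ≤ᵐ[loebMeasure d ω]
          {z | min δ (((n : ℝ) + 1)⁻¹ / 2) ≤
            ‖∑ i, c i • f (Φ i z) - ∫ y, f y ∂(haarSub Y : Measure X)‖} := by
        filter_upwards [ae_all_iff.2 hφ] with z hz hzV
        change _ ≤ _
        by_contra hlt
        refine hzV ?_
        -- The convex combination of point masses depends continuously on the points, so it commutes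
        -- with ultralimits.
        have h1 : ulimMap ω (fun k j => κ fun i => φ i k j) z = κ fun i => Φ i z := by
          rw [ulimMap_comp (fun k j i => φ i k j) hκ, ulimMap_pi]
          exact congrArg κ (funext hz)
        change ulimMap ω (fun k j => κ fun i => φ i k j) z ∈ V
        rw [h1]
        refine hfδ _ ?_
        rw [integral_diracCombination hc0 hc1 _ hf]
        exact (not_le.1 hlt).trans_le (min_le_left _ _)
      have h2 := (measure_mono_ae hbad).trans hclose
      have h3 : ENNReal.ofReal (min δ (((n : ℝ) + 1)⁻¹ / 2)) < ((n : ENNReal) + 1)⁻¹ := by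
        have h4 : ((n : ENNReal) + 1)⁻¹ = ENNReal.ofReal (((n : ℝ) + 1)⁻¹) := by
          rw [ENNReal.ofReal_inv_of_pos (by positivity), ENNReal.ofReal_add (by positivity)
            zero_le_one, ENNReal.ofReal_natCast, ENNReal.ofReal_one]
        rw [h4, ENNReal.ofReal_lt_ofReal_iff (by positivity)]
        exact (min_le_right _ _).trans_lt (half_lt_self (by positivity))
      have h5 : loebMeasure d ω (internalSet ω fun k => {j | κ (fun i => φ i k j) ∈ V})ᶜ <
          ((n : ENNReal) + 1)⁻¹ :=
        ((measure_mono (compl_subset_compl.2 hsub)).trans h2).trans_lt h3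
      rw [prob_compl_eq_one_sub (measurableSet_internalSet _)] at h5
      have hinv1 : ((n : ENNReal) + 1)⁻¹ ≤ 1 := ENNReal.inv_le_one.2 le_add_self
      by_contra hcon
      have h6 := tsub_le_tsub_left (not_lt.1 hcon) 1
      rw [ENNReal.sub_sub_cancel ENNReal.one_ne_top hinv1] at h6
      exact absurd h5 (not_lt.2 h6)
    filter_upwards [hnear, (tendsto_unif_internalSet hω hd _).eventually_const_lt hlarge]
      with k hk1 hk2
    refine ⟨diracCombination hc0 hc1 fun i => φ i k, fun i hi =>
      diracCombination_eq_one hc0 hc1 fun l => hk1 l i hi, hk2.trans_le (measure_mono ?_)⟩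
    intro j hj
    refine hVO ?_
    rw [marginal_diracCombination]
    exact hj
  have : ∀ k, Nonempty (ProbabilityMeasure (Fin (d k) → X)) := fun k =>
    ⟨⟨Measure.dirac 1, inferInstance⟩⟩
  obtain ⟨N, μ, hN, hμ⟩ := hω.exists_diagonal_seq hP
  refine ⟨μ, fun h V hV hdV δ hδ => ?_, fun W hW => ?_⟩
  · obtain ⟨n, rfl, hUV, hεδ⟩ := htest h V δ hV hdV hδ
    refine tendsto_const_nhds.congr' ?_
    filter_upwards [hμ, hN.eventually_ge_atTop n] with k hk1 hk2
    refine le_antisymm ?_ prob_le_one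
    exact (hk1.1 n (Finset.mem_range.2 (by omega))).ge.trans
      (measure_mono (nearMicrostates_mono (σ k) _ hUV hεδ))
  · obtain ⟨n, hn⟩ := hO.mem_iff.1 hW
    have h1 := ENNReal.Tendsto.sub (tendsto_const_nhds (x := (1 : ENNReal)))
      (tendsto_inv_nat_add_one.comp hN) (Or.inl ENNReal.one_ne_top)
    rw [tsub_zero] at h1
    refine tendsto_of_tendsto_of_tendsto_of_le_of_le' h1 tendsto_const_nhds ?_
      (Eventually.of_forall fun k => prob_le_one)
    filter_upwards [hμ, hN.eventually_ge_atTop n] with k hk1 hk2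
    exact hk1.2.le.trans (measure_mono fun j hj => hn (hO.antitone hk2 hj))

-- The marginal limit equals `m` almost everywhere, so a single generic `z` transfers concentration
-- from the marginal limit to `m`.
omit [IsTopologicalGroup X] in
theorem IsLocalWeakStarLimit.ae_mem_absorbingSubgroup [Countable G] [ContinuousConstSMul G X]
    (hω : IsFree ω) (hd : ∀ k, 0 < d k) {m : ProbabilityMeasure X}
    (hm : IsLocalWeakStarLimit ω σ m) :
    ∀ᵐ x ∂(m : Measure X), x ∈ (absorbingSubgroup X ω σ : Set X) := by
  have := isProbabilityMeasure_loebMeasure hω hd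
  obtain ⟨μ, hμ, hμm⟩ := hm
  have h1 := (locallyWeakStarTendsto_iff hω hd).1 hμm
  have h2 := ae_marginalLimit_mem hω hd hμ (absorbingSubgroup X ω σ).isClosed'
    ⟨1, one_mem (absorbingSubgroup X ω σ)⟩ absorbs_absorbingSubgroup
  obtain ⟨z, hz1, hz2⟩ := (h1.and h2).exists
  rw [hz1] at hz2
  exact hz2

end Group

end

end SoficAlg

/-! ### The main theorem. -/

open SoficAlg

theorem corollary1p4 {G : Type*} [Group G] [Countable G]
    {X : Type*} [Group X] [TopologicalSpace X] [IsTopologicalGroup X] [CompactSpace X]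
    [TopologicalSpace.MetrizableSpace X] [MeasurableSpace X] [BorelSpace X]
    [MulDistribMulAction G X] [ContinuousConstSMul G X]
    (d : ℕ → ℕ) (hd : ∀ k, 0 < d k) (σ : ∀ k, G → Equiv.Perm (Fin (d k)))
    (hσ : SoficAlg.IsSoficApprox σ)
    (ω : Ultrafilter ℕ) (hω : SoficAlg.IsFree ω)
    (herg : SoficAlg.HasErgodicCentralizer ω σ) :
    ∃ Y : ClosedSubgroup X,
      SoficAlg.GInvariant G Y ∧
      IsGreatest (SoficAlg.genSubgroups (X := X) ω σ)
        (MeasureTheory.AEEqFun.const (SoficAlg.LoebSpace d ω) Y) ∧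
      IsGreatest {H : ClosedSubgroup X |
        SoficAlg.IsLocalWeakStarLimit ω σ (SoficAlg.haarSub H)} Y ∧
      IsLeast {H : ClosedSubgroup X | SoficAlg.Absorbs ω σ (H : Set X)} Y ∧
      (¬ SoficAlg.IsLocalWeakStarLimit ω σ (SoficAlg.haarProb X) ↔
        ∃ H : ClosedSubgroup X, (H : Set X) ≠ Set.univ ∧ SoficAlg.GInvariant G H ∧
          SoficAlg.Absorbs ω σ (H : Set X)) := by
  have := isProbabilityMeasure_loebMeasure hω hd
  set Y := absorbingSubgroup X ω σ with hY
  have hlim : IsLocalWeakStarLimit ω σ (haarSub Y) :=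
    isLocalWeakStarLimit_absorbingSubgroup hω hd herg
  refine ⟨Y, gInvariant_absorbingSubgroup hω hd, ⟨?_, ?_⟩, ⟨hlim, ?_⟩,
    ⟨absorbs_absorbingSubgroup, fun H hH => absorbingSubgroup_le hH⟩, ?_, ?_⟩
  · obtain ⟨μ, hμ, hμY⟩ := hlim
    refine ⟨AEEqFun.const _ (haarSub Y), ⟨μ, hμ, ?_⟩, ?_⟩
    · filter_upwards [AEEqFun.coeFn_const (μ := loebMeasure d ω) _ (haarSub Y),
        (locallyWeakStarTendsto_iff hω hd).1 hμY] with z h1 h2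
      rw [h1, h2, Function.const_apply]
    · filter_upwards [AEEqFun.coeFn_const (μ := loebMeasure d ω) _ (haarSub Y),
        AEEqFun.coeFn_const (μ := loebMeasure d ω) _ Y] with z h1 h2
      rw [h1, h2, Function.const_apply, Function.const_apply]
  · rintro F ⟨f, ⟨μ, hμ, hfμ⟩, hfF⟩
    rw [← AEEqFun.coeFn_le]
    filter_upwards [AEEqFun.coeFn_const (μ := loebMeasure d ω) _ Y, hfμ, hfF,
      ae_marginalLimit_mem hω hd hμ Y.isClosed' ⟨1, one_mem Y⟩ absorbs_absorbingSubgroup]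
      with z h1 h2 h3 h4
    rw [h1, Function.const_apply]
    rw [← h2, h3] at h4
    -- Here `h4` says that the Haar measure of `F z` is concentrated on the closed set `Y`; its
    -- support is all of `F z`.
    exact subset_of_ae_haarSub_mem (F z) Y.isClosed' h4
  · intro H hH
    exact subset_of_ae_haarSub_mem H Y.isClosed' (hH.ae_mem_absorbingSubgroup hω hd)
  · intro hX
    refine ⟨Y, fun hYX => hX ?_, gInvariant_absorbingSubgroup hω hd, absorbs_absorbingSubgroup⟩
    rwa [← haarSub_eq_haarProb hYX]
  · rintro ⟨H, hHX, -, hH⟩ hX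
    refine hHX (eq_univ_of_univ_subset ?_)
    -- With `X` viewed as a closed subgroup of itself, its Haar measure is concentrated on `Y`, so
    -- `X ⊆ Y ⊆ H`.
    let T : ClosedSubgroup X := { toSubgroup := ⊤, isClosed' := isClosed_univ }
    have hT : (T : Set X) = univ := rfl
    rw [← haarSub_eq_haarProb hT] at hX
    exact (subset_of_ae_haarSub_mem T Y.isClosed' (hX.ae_mem_absorbingSubgroup hω hd)).trans
      (absorbingSubgroup_le hH)
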